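/- Let $\mathscr G$ be a (non-empty) ample groupoid, i.e. a topological groupoid whose unit space $\mathscr G^{(0)}$ is Hausdorff, locally compact and has a basis of compact open sets, and whose range map $r$ is a local homeomorphism onto $\mathscr G^{(0)}$; write $d$ for the source map. The arrow space itself need not be Hausdorff. A bisection is a set of arrows on which $d$ and $r$ are injective. Let $\mathcal O$ be a $\mathscr G$-sheaf of fields: a local homeomorphism $p\colon E\to\mathscr G^{(0)}$ whose stalks $\mathcal O_x=p^{-1}(x)$ are fields, with fibrewise addition and multiplication continuous and $x\mapsto 1_x$ continuous, together with a continuous action $(\gamma,e)\mapsto\alpha_\gamma(e)$, defined for $d(\gamma)=p(e)$, by unital ring homomorphisms $\alpha_\gamma\colon\mathcal O_{d(\gamma)}\to\mathcal O_{r(\gamma)}$ such that $\alpha_x=\mathrm{id}$ for units $x$ and $\alpha_\beta\alpha_\gamma=\alpha_{\beta\gamma}$ whenever $\beta\gamma$ is defined. For an open subgroupoid $\mathscr H$ of $\mathscr G$, let $\Gamma_c(\mathscr H,\mathcal O)$ be the additive group generated by the maps $f\colon\mathscr G\to E$ with $p\circ f=r$ for which there is a compact open bisection $U\subseteq\mathscr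 H$ such that $f$ is continuous on $U$ and zero outside $U$. The group $\Gamma_c(\mathscr G,\mathcal O)$ is a ring under the convolution $(f*g)(\gamma)=\sum_{\beta\rho=\gamma}f(\beta)\,\alpha_\beta(g(\rho))$. The ring $\Gamma_c(\mathscr G^{(0)},\mathcal O)$ of compactly supported continuous sections over $\mathscr G^{(0)}$, with pointwise operations, is a subring of it via extension by zero. Put $\operatorname{supp} f=\{\gamma: f(\gamma)\ne 0\}$, $\ker\mathcal O=\{\gamma : d(\gamma)=r(\gamma),\ \alpha_\gamma=\mathrm{id}\}$, and let $\operatorname{Int}$ denote the interior in the arrow space. The groupoid $\mathscr G$ is minimal if $\emptyset$ and $\mathscr G^{(0)}$ are the only open subsets $V$ of $\mathscr G^{(0)}$ such that $d(\gamma)\in V$ implies $r(\gamma)\in V$ for every arrow $\gamma$. Let $\mathscr G^a$ be the inverse semigroup of compact open bisections. Each $U\in\mathscr G^a$ defines an isomorphism $\tilde\alpha_U$ from the ideal of sections in $\Gamma_c(\mathscr G^{(0)},\mathcal O)$ that vanish outside $d(U)$ to the ideal of those that vanish outside $r(U)$, by $\tilde\alpha_U(s)(r(\gamma))=\alpha_\gamma(s(d(\gamma)))$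 for $\gamma\in U$. An ideal $I$ is $\mathscr G^a$-invariant if $\tilde\alpha_U(s)\in I$ for all $U\in\mathscr G^a$ and all $s\in I$ vanishing outside $d(U)$. The ring $\Gamma_c(\mathscr G^{(0)},\mathcal O)$ is $\mathscr G^a$-simple if $0$ and the whole ring are its only $\mathscr G^a$-invariant ideals. Then the following are equivalent: 1. $\Gamma_c(\mathscr G,\mathcal O)$ is simple; 2. $\Gamma_c(\mathscr G^{(0)},\mathcal O)$ is $\mathscr G^a$-simple and a maximal commutative subring of $\Gamma_c(\mathscr G,\mathcal O)$; 3. $\mathscr G$ is minimal, $\operatorname{Int}(\ker\mathcal O)=\mathscr G^{(0)}$, and $\Gamma_c(\operatorname{Int}(\ker\mathcal O),\mathcal O)=\{f\in\Gamma_c(\mathscr G,\mathcal O) : \operatorname{supp}(f)\subseteq\ker\mathcal O\}$. If moreover $\mathscr G$ is Hausdorff, these are also equivalent to: 4. $\mathscr G$ is minimal and $\operatorname{Int}(\ker\mathcal O)=\mathscr G^{(0)}$. -/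

import Mathlib

open CategoryTheory Topology TopologicalSpace

universe w v u

/-! ### Ample groupoids

A groupoid is Mathlib's `Groupoid` on a type `X` of units; its arrow space is `Quiver.Total X`.
For `γ : Quiver.Total X`, the source is `γ.left`, the range is `γ.right`; the product `βρ` of arrows
with source of `β` equal to the range of `ρ` is `ρ ≫ β`. -/

/-- A pair `(β, ρ)` of arrows such that the product `βρ` is defined. -/
structure ComposablePair (X : Type u) [Groupoid.{v} X] where
  {x y z : X}
  outer : y ⟶ z
  inner : x ⟶ y

namespace ComposablePair

variable {X : Type u} [Groupoid.{v} X]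

/-- The inclusion of the composable pairs in the square of the arrow space. -/
def toProd (q : ComposablePair X) : Quiver.Total X × Quiver.Total X :=
  (⟨q.y, q.z, q.outer⟩, ⟨q.x, q.y, q.inner⟩)

/-- The product `βρ`. -/
def mul (q : ComposablePair X) : Quiver.Total X := ⟨q.x, q.z, q.inner ≫ q.outer⟩

/-- Composable pairs carry the subspace topology of the product topology. -/
instance [TopologicalSpace (Quiver.Total X)] : TopologicalSpace (ComposablePair X) :=
  TopologicalSpace.induced toProd inferInstance

end ComposablePair

/-- An ample groupoid: a topological groupoid with locally compact Hausdorff unit space, whose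
range map is a local homeomorphism and whose unit space has a basis of compact open sets.
The topology of `X` is the one of the unit space, that is, the inclusion of the units in the arrow
space is continuous (hence a homeomorphism onto its image, the source map being continuous). -/
class AmpleGroupoid (X : Type u) [Groupoid.{v} X] [TopologicalSpace X]
    [TopologicalSpace (Quiver.Total X)] : Prop where
  continuous_source : Continuous fun γ : Quiver.Total X => γ.left
  continuous_range : Continuous fun γ : Quiver.Total X => γ.right
  continuous_unit : Continuous fun x : X => (⟨x, x, 𝟙 x⟩ : Quiver.Total X)
  continuous_inv : Continuous fun γ : Quiver.Total X =>
    (⟨γ.right, γ.left, Groupoid.inv γ.hom⟩ : Quiver.Total X)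
  continuous_mul : Continuous (ComposablePair.mul : ComposablePair X → Quiver.Total X)
  t2 : T2Space X
  locallyCompact : LocallyCompactSpace X
  isLocalHomeomorph_range : IsLocalHomeomorph fun γ : Quiver.Total X => γ.right
  isTopologicalBasis : IsTopologicalBasis {U : Set X | IsOpen U ∧ IsCompact U}

section Groupoid

variable (X : Type u) [Groupoid.{v} X]

/-- The set of units, inside the arrow space. -/
def unitArrows : Set (Quiver.Total X) := Set.range fun x : X => ⟨x, x, 𝟙 x⟩

/-- A groupoid is minimal if the only open invariant subsets of the unit space are the trivial
ones. -/
def IsMinimalGroupoid [TopologicalSpace X] : Prop :=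
  ∀ U : Set X, IsOpen U → (∀ γ : Quiver.Total X, γ.left ∈ U → γ.right ∈ U) →
    U = ∅ ∨ U = Set.univ

variable {X}

/-- Compact open bisections. (The source and range maps are injective on such a set; as the unit
space of an ample groupoid is Hausdorff, such a set is automatically a Hausdorff subspace.) -/
structure IsCompactOpenBisection [TopologicalSpace (Quiver.Total X)] (U : Set (Quiver.Total X)) :
    Prop where
  isOpen : IsOpen U
  isCompact : IsCompact U
  source_injOn : Set.InjOn (fun γ : Quiver.Total X => γ.left) U
  range_injOn : Set.InjOn (fun γ : Quiver.Total X => γ.right) U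

end Groupoid

/-! ### Sheaves of rings over a groupoid -/

/-- Pairs of elements in the same stalk, i.e. the pullback `E ×_{p,p} E`, where
`E = Σ x, S x` and `p : E → X` is the projection. -/
structure FiberPair {X : Type u} (S : X → Type w) where
  pt : X
  fst : S pt
  snd : S pt

/-- Pairs `(γ, e)` with `e` in the stalk at the source of `γ`. -/
structure ActionPair {X : Type u} [Groupoid.{v} X] (S : X → Type w) where
  arrow : Quiver.Total X
  val : S arrow.left

namespace FiberPair

variable {X : Type u} {S : X → Type w}

/-- The inclusion in `E × E`. -/
def toProd (q : FiberPair S) : (Σ x, S x) × (Σ x, S x) := (⟨q.pt, q.fst⟩, ⟨q.pt, q.snd⟩)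

instance [TopologicalSpace (Σ x, S x)] : TopologicalSpace (FiberPair S) :=
  TopologicalSpace.induced toProd inferInstance

end FiberPair

namespace ActionPair

variable {X : Type u} [Groupoid.{v} X] {S : X → Type w}

/-- The inclusion in the product of the arrow space and `E`. -/
def toProd (q : ActionPair S) : Quiver.Total X × (Σ x, S x) := (q.arrow, ⟨q.arrow.left, q.val⟩)

instance [TopologicalSpace (Quiver.Total X)] [TopologicalSpace (Σ x, S x)] :
    TopologicalSpace (ActionPair S) :=
  TopologicalSpace.induced toProd inferInstance

end ActionPair

/-- A sheaf of unital rings over a topological groupoid, presented by its family of stalks and a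
topology on the total space `E = Σ x, stalk x`. -/
structure GroupoidSheafOfRings (X : Type u) [Groupoid.{v} X] [TopologicalSpace X]
    [TopologicalSpace (Quiver.Total X)] where
  stalk : X → Type w
  [ring : ∀ x, Ring (stalk x)]
  [top : TopologicalSpace (Σ x, stalk x)]
  isLocalHomeomorph_proj : IsLocalHomeomorph (Sigma.fst : (Σ x, stalk x) → X)
  /-- The action of an arrow, a unital ring homomorphism between stalks. -/
  act : ∀ {x y : X}, (x ⟶ y) → stalk x →+* stalk y
  act_id : ∀ (x : X) (a : stalk x), act (𝟙 x) a = a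
  act_comp : ∀ {x y z : X} (ρ : x ⟶ y) (β : y ⟶ z) (a : stalk x),
    act (ρ ≫ β) a = act β (act ρ a)
  continuous_act : Continuous fun q : ActionPair stalk =>
    (⟨q.arrow.right, act q.arrow.hom q.val⟩ : Σ x, stalk x)
  continuous_add : Continuous fun q : FiberPair stalk => (⟨q.pt, q.fst + q.snd⟩ : Σ x, stalk x)
  continuous_mul : Continuous fun q : FiberPair stalk => (⟨q.pt, q.fst * q.snd⟩ : Σ x, stalk x)
  continuous_one : Continuous fun x : X => (⟨x, 1⟩ : Σ x, stalk x)

namespace GroupoidSheafOfRings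

attribute [instance] ring top

variable {X : Type u} [Groupoid.{v} X] [TopologicalSpace X] [TopologicalSpace (Quiver.Total X)]

/-- A sheaf of fields: every stalk is a (commutative) field. -/
def IsSheafOfFields (O : GroupoidSheafOfRings.{w} X) : Prop := ∀ x, IsField (O.stalk x)

/-- The kernel: the isotropy arrows that act trivially. -/
def ker (O : GroupoidSheafOfRings.{w} X) : Set (Quiver.Total X) :=
  {γ | ∃ (x : X) (g : x ⟶ x), γ = ⟨x, x, g⟩ ∧ ∀ a : O.stalk x, O.act g a = a}

/-- The support of a map assigning to each arrow an element of the stalk at its range. -/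
def supp (O : GroupoidSheafOfRings.{w} X) (f : ∀ γ : Quiver.Total X, O.stalk γ.right) :
    Set (Quiver.Total X) := {γ | f γ ≠ 0}

/-- The maps `f` that are continuous on, and vanish outside of, the set `U`. -/
def SupportedOn (O : GroupoidSheafOfRings.{w} X) (f : ∀ γ : Quiver.Total X, O.stalk γ.right)
    (U : Set (Quiver.Total X)) : Prop :=
  ContinuousOn (fun γ => (⟨γ.right, f γ⟩ : Σ x, O.stalk x)) U ∧ ∀ γ ∉ U, f γ = 0

/-- For an open set `H` of arrows (in particular for an open subgroupoid `H`), the additive group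
`Γ_c(H, O)`, generated by the maps supported on a compact open bisection contained in `H`. -/
def sectionsIn (O : GroupoidSheafOfRings.{w} X) (H : Set (Quiver.Total X)) :
    AddSubgroup (∀ γ : Quiver.Total X, O.stalk γ.right) :=
  AddSubgroup.closure {f | ∃ U, IsCompactOpenBisection U ∧ U ⊆ H ∧ O.SupportedOn f U}

/-- The convolution algebra `Γ_c(G, O)`, as an additive group. -/
def convAlgebra (O : GroupoidSheafOfRings.{w} X) :
    AddSubgroup (∀ γ : Quiver.Total X, O.stalk γ.right) :=
  O.sectionsIn Set.univ

/-- The convolution `(f * g)(γ) = ∑_{βρ = γ} f(β) α_β(g(ρ))`. The factorizations `γ = βρ` are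
indexed by the arrows `β` with the same range as `γ`, and `ρ = β⁻¹γ`. -/
noncomputable def conv (O : GroupoidSheafOfRings.{w} X)
    (f g : ∀ γ : Quiver.Total X, O.stalk γ.right) (γ : Quiver.Total X) : O.stalk γ.right :=
  ∑ᶠ β : Σ z : X, z ⟶ γ.right,
    f ⟨β.1, γ.right, β.2⟩ * O.act β.2 (g ⟨γ.left, β.1, γ.hom ≫ Groupoid.inv β.2⟩)

/-! ### The convolution product on `Γ_c(G, O)` -/

lemma finite_fiber (O : GroupoidSheafOfRings.{w} X) {f : ∀ γ : Quiver.Total X, O.stalk γ.right}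
    (hf : f ∈ O.convAlgebra) (y : X) :
    {β : Σ z : X, z ⟶ y | f ⟨β.1, y, β.2⟩ ≠ 0}.Finite := by
  induction hf using AddSubgroup.closure_induction with
  | mem f hf =>
    obtain ⟨U, hU, -, hf⟩ := hf
    apply Set.Subsingleton.finite
    rintro ⟨z, β⟩ hβ ⟨z', β'⟩ hβ'
    have h1 : (⟨z, y, β⟩ : Quiver.Total X) ∈ U := by
      by_contra h; exact hβ (hf.2 _ h)
    have h2 : (⟨z', y, β'⟩ : Quiver.Total X) ∈ U := by
      by_contra h; exact hβ' (hf.2 _ h)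
    have := hU.range_injOn h1 h2 rfl
    simp only [Quiver.Total.mk.injEq] at this
    obtain ⟨rfl, -, h⟩ := this
    rw [eq_of_heq h]
  | zero => simp
  | add f g _ _ hf hg =>
    refine (hf.union hg).subset ?_
    intro β hβ
    by_contra h
    simp only [Set.mem_union, Set.mem_ofPred_eq, not_or, not_not] at h
    exact hβ (by simp [h.1, h.2])
  | neg f _ hf => simpa using hf

lemma hasFiniteSupport_conv (O : GroupoidSheafOfRings.{w} X)
    {f : ∀ γ : Quiver.Total X, O.stalk γ.right} (hf : f ∈ O.convAlgebra)
    (y : X) (k : (Σ z : X, z ⟶ y) → O.stalk y) :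
    Function.HasFiniteSupport (M := O.stalk y)
      (fun β : Σ z : X, z ⟶ y => f ⟨β.1, y, β.2⟩ * k β) := by
  refine (O.finite_fiber hf y).subset ?_
  intro β hβ h
  exact hβ (by simp [h])

lemma conv_add (O : GroupoidSheafOfRings.{w} X) {f : ∀ γ : Quiver.Total X, O.stalk γ.right}
    (hf : f ∈ O.convAlgebra) (g h : ∀ γ : Quiver.Total X, O.stalk γ.right) :
    O.conv f (g + h) = O.conv f g + O.conv f h := by
  funext γ
  simp only [conv, Pi.add_apply, map_add, mul_add]
  exact finsum_add_distrib (O.hasFiniteSupport_conv hf _ _) (O.hasFiniteSupport_conv hf _ _)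

lemma add_conv (O : GroupoidSheafOfRings.{w} X) {f g : ∀ γ : Quiver.Total X, O.stalk γ.right}
    (hf : f ∈ O.convAlgebra) (hg : g ∈ O.convAlgebra)
    (h : ∀ γ : Quiver.Total X, O.stalk γ.right) :
    O.conv (f + g) h = O.conv f h + O.conv g h := by
  funext γ
  simp only [conv, Pi.add_apply, add_mul]
  exact finsum_add_distrib (O.hasFiniteSupport_conv hf _ _) (O.hasFiniteSupport_conv hg _ _)

lemma conv_zero (O : GroupoidSheafOfRings.{w} X) (f : ∀ γ : Quiver.Total X, O.stalk γ.right) :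
    O.conv f 0 = 0 := by
  funext γ
  simp [conv]

lemma zero_conv (O : GroupoidSheafOfRings.{w} X) (f : ∀ γ : Quiver.Total X, O.stalk γ.right) :
    O.conv 0 f = 0 := by
  funext γ
  simp [conv]

lemma conv_neg (O : GroupoidSheafOfRings.{w} X) (f g : ∀ γ : Quiver.Total X, O.stalk γ.right) :
    O.conv f (-g) = -O.conv f g := by
  funext γ
  simp [conv, finsum_neg_distrib]

lemma neg_conv (O : GroupoidSheafOfRings.{w} X) (f g : ∀ γ : Quiver.Total X, O.stalk γ.right) :
    O.conv (-f) g = -O.conv f g := by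
  funext γ
  simp [conv, finsum_neg_distrib]

/-- If `δ` is the only arrow with range `y` at which `f` may be nonzero, then the convolution sum
reduces to one term. -/
lemma conv_apply_of_unique (O : GroupoidSheafOfRings.{w} X)
    (f g : ∀ γ : Quiver.Total X, O.stalk γ.right) {x y z : X} (δ : z ⟶ y)
    (hδ : ∀ β : Σ z : X, z ⟶ y, β ≠ ⟨z, δ⟩ → f ⟨β.1, y, β.2⟩ = 0) (γ : x ⟶ y) :
    O.conv f g ⟨x, y, γ⟩ = f ⟨z, y, δ⟩ * O.act δ (g ⟨x, z, γ ≫ Groupoid.inv δ⟩) := by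
  refine finsum_eq_single _ (⟨z, δ⟩ : Σ z : X, z ⟶ y) ?_
  intro β hβ
  simp [hδ β hβ]

lemma SupportedOn.eq_zero_of_ne {O : GroupoidSheafOfRings.{w} X}
    {f : ∀ γ : Quiver.Total X, O.stalk γ.right} {U : Set (Quiver.Total X)}
    (hU : IsCompactOpenBisection U) (hf : O.SupportedOn f U) {y z : X} {δ : z ⟶ y}
    (hδ : ⟨z, y, δ⟩ ∈ U) (β : Σ z : X, z ⟶ y) (hβ : β ≠ ⟨z, δ⟩) :
    f ⟨β.1, y, β.2⟩ = 0 := by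
  apply hf.2
  intro h
  apply hβ
  have := hU.range_injOn h hδ rfl
  obtain ⟨z', β⟩ := β
  simp only [Quiver.Total.mk.injEq] at this
  obtain ⟨rfl, -, h⟩ := this
  rw [eq_of_heq h]

lemma SupportedOn.exists_unique {O : GroupoidSheafOfRings.{w} X}
    {f : ∀ γ : Quiver.Total X, O.stalk γ.right} {U : Set (Quiver.Total X)}
    (hU : IsCompactOpenBisection U) (hf : O.SupportedOn f U) (y : X) :
    ∃ δ : Σ z : X, z ⟶ y, ∀ β : Σ z : X, z ⟶ y, β ≠ δ → f ⟨β.1, y, β.2⟩ = 0 := by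
  by_cases h : ∃ δ : Σ z : X, z ⟶ y, ⟨δ.1, y, δ.2⟩ ∈ U
  · obtain ⟨δ, hδ⟩ := h
    exact ⟨δ, hf.eq_zero_of_ne hU hδ⟩
  · push Not at h
    exact ⟨⟨y, 𝟙 y⟩, fun β _ => hf.2 _ (h β)⟩

end GroupoidSheafOfRings

/-- The first projection of the pullback of an open map is open. -/
lemma isOpenMap_fst_of_pullback {P A B C : Type*} [TopologicalSpace P] [TopologicalSpace A]
    [TopologicalSpace B] [TopologicalSpace C] {i : P → A × B} (hi : IsInducing i)
    {f : A → C} {g : B → C} (hf : Continuous f) (hg : IsOpenMap g)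
    (hr : ∀ a b, f a = g b → (a, b) ∈ Set.range i) (hr' : ∀ p, f (i p).1 = g (i p).2) :
    IsOpenMap fun p => (i p).1 := by
  intro W hW
  obtain ⟨V, hV, rfl⟩ := hi.isOpen_iff.1 hW
  rw [isOpen_iff_mem_nhds]
  rintro _ ⟨p, hp, rfl⟩
  obtain ⟨A₀, B₀, hA₀, hB₀, hpA, hpB, hAB⟩ := isOpen_prod_iff.1 hV (i p).1 (i p).2 hp
  refine Filter.mem_of_superset ((hA₀.inter ((hg _ hB₀).preimage hf)).mem_nhds
    ⟨hpA, ⟨_, hpB, (hr' p).symm⟩⟩) ?_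
  rintro a ⟨ha, b, hb, hab⟩
  obtain ⟨q, hq⟩ := hr a b hab.symm
  exact ⟨q, by rw [Set.mem_preimage, hq]; exact hAB ⟨ha, hb⟩, by simp [hq]⟩


namespace AmpleGroupoid

variable {X : Type u} [Groupoid.{v} X] [TopologicalSpace (Quiver.Total X)]

lemma continuous_outer : Continuous fun q : ComposablePair X =>
    (⟨q.y, q.z, q.outer⟩ : Quiver.Total X) :=
  continuous_fst.comp (continuous_induced_dom (f := ComposablePair.toProd))

lemma continuous_inner : Continuous fun q : ComposablePair X =>
    (⟨q.x, q.y, q.inner⟩ : Quiver.Total X) :=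
  continuous_snd.comp (continuous_induced_dom (f := ComposablePair.toProd))

variable [TopologicalSpace X] [AmpleGroupoid X]

lemma continuous_toProd_comp {Y : Type*} [TopologicalSpace Y] {F : Y → ComposablePair X}
    (h : Continuous fun t => ((F t).mul, (⟨(F t).y, (F t).z, (F t).outer⟩ : Quiver.Total X))) :
    Continuous fun t => (F t).toProd := by
  have h1 := continuous_fst.comp h
  have h2 := continuous_snd.comp h
  have h4 : Continuous fun t =>
      (⟨Groupoid.inv (F t).outer, (F t).inner ≫ (F t).outer⟩ : ComposablePair X) :=
    continuous_induced_rng.2 ((continuous_inv.comp h2).prodMk h1)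
  refine h2.prodMk ?_
  convert continuous_mul.comp h4 using 2 with t
  simp [ComposablePair.mul]

lemma isInducing_shear : IsInducing fun q : ComposablePair X =>
    (q.mul, (⟨q.y, q.z, q.outer⟩ : Quiver.Total X)) := by
  constructor
  apply le_antisymm
  · exact continuous_iff_le_induced.1 (continuous_mul.prodMk continuous_outer)
  · exact continuous_iff_le_induced.1
      (@continuous_toProd_comp X _ _ _ _ (ComposablePair X) (TopologicalSpace.induced
        (fun q : ComposablePair X => (q.mul, (⟨q.y, q.z, q.outer⟩ : Quiver.Total X))) inferInstance)
        id continuous_induced_dom)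

lemma isOpenMap_mul : IsOpenMap (ComposablePair.mul : ComposablePair X → Quiver.Total X) := by
  refine isOpenMap_fst_of_pullback isInducing_shear
    (f := fun γ => γ.right) (g := fun γ => γ.right) continuous_range
    isLocalHomeomorph_range.isOpenMap ?_ ?_
  · rintro ⟨x, z, a⟩ ⟨y, z', b⟩ h
    obtain rfl : z = z' := h
    exact ⟨⟨b, a ≫ Groupoid.inv b⟩, by simp [ComposablePair.mul]⟩
  · intro q; rfl

/-- The product of two compact open bisections. -/
lemma isCompactOpenBisection_mul {U V : Set (Quiver.Total X)} (hU : IsCompactOpenBisection U)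
    (hV : IsCompactOpenBisection V) :
    IsCompactOpenBisection (ComposablePair.mul '' (ComposablePair.toProd ⁻¹' (U ×ˢ V))) := by
  have ho : IsOpen (ComposablePair.toProd ⁻¹' (U ×ˢ V) : Set (ComposablePair X)) :=
    (hU.isOpen.prod hV.isOpen).preimage continuous_induced_dom
  have := t2 (X := X)
  refine ⟨isOpenMap_mul _ ho, ?_, ?_, ?_⟩
  · refine IsCompact.image ?_ continuous_mul
    refine IsInducing.isCompact_preimage (f := ComposablePair.toProd) ⟨rfl⟩ ?_
      (hU.isCompact.prod hV.isCompact)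
    have : Set.range (ComposablePair.toProd : ComposablePair X → _) =
        {p | p.1.left = p.2.right} := by
      ext ⟨⟨x, y, a⟩, ⟨x', y', b⟩⟩
      constructor
      · rintro ⟨q, hq⟩
        simp only [ComposablePair.toProd, Prod.mk.injEq, Quiver.Total.mk.injEq] at hq
        exact hq.1.1.symm.trans hq.2.2.1
      · intro h
        obtain rfl : x = y' := h
        exact ⟨⟨a, b⟩, rfl⟩
    rw [this]
    exact isClosed_eq (continuous_source.comp continuous_fst) (continuous_range.comp continuous_snd)
  · rintro _ ⟨⟨β, ρ⟩, hq, rfl⟩ _ ⟨⟨β', ρ'⟩, hq', rfl⟩ h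
    have h1 := hV.source_injOn hq.2 hq'.2 h
    simp only [ComposablePair.toProd, Quiver.Total.mk.injEq] at h1
    obtain ⟨rfl, rfl, h1⟩ := h1
    obtain rfl := eq_of_heq h1
    have h2 := hU.source_injOn hq.1 hq'.1 rfl
    simp only [ComposablePair.toProd, Quiver.Total.mk.injEq] at h2
    obtain ⟨-, rfl, h2⟩ := h2
    rw [eq_of_heq h2]
  · rintro _ ⟨⟨β, ρ⟩, hq, rfl⟩ _ ⟨⟨β', ρ'⟩, hq', rfl⟩ h
    have h1 := hU.range_injOn hq.1 hq'.1 h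
    simp only [ComposablePair.toProd, Quiver.Total.mk.injEq] at h1
    obtain ⟨rfl, rfl, h1⟩ := h1
    obtain rfl := eq_of_heq h1
    have h2 := hV.range_injOn hq.2 hq'.2 rfl
    simp only [ComposablePair.toProd, Quiver.Total.mk.injEq] at h2
    obtain ⟨rfl, -, h2⟩ := h2
    rw [eq_of_heq h2]

/-- The unit space is open in the arrow space. -/
lemma isOpen_unitArrows : IsOpen (unitArrows X) := by
  rw [isOpen_iff_mem_nhds]
  rintro _ ⟨x, rfl⟩
  obtain ⟨W, hW, hxW, hinj⟩ :=
    (isLocalHomeomorph_range (X := X)).isLocallyInjective ⟨x, x, 𝟙 x⟩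
  have hW' := hW.preimage ((continuous_unit (X := X)).comp continuous_range)
  refine Filter.mem_of_superset ((hW.inter hW').mem_nhds ⟨hxW, hxW⟩) ?_
  rintro γ ⟨h1, h2⟩
  exact ⟨γ.right, hinj h2 h1 rfl⟩

end AmpleGroupoid

namespace GroupoidSheafOfRings

variable {X : Type u} [Groupoid.{v} X] [TopologicalSpace (Quiver.Total X)]

lemma isInducing_fiberPair {Y : Type u} {S : Y → Type w} [TopologicalSpace (Σ x, S x)] :
    IsInducing (FiberPair.toProd : FiberPair S → _) := ⟨rfl⟩

lemma isInducing_actionPair {S : X → Type w} [TopologicalSpace (Σ x, S x)] :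
    IsInducing (ActionPair.toProd : ActionPair S → _) := ⟨rfl⟩

variable [TopologicalSpace X]

lemma SupportedOn.conv [AmpleGroupoid X] {O : GroupoidSheafOfRings.{w} X}
    {f g : ∀ γ : Quiver.Total X, O.stalk γ.right} {U V : Set (Quiver.Total X)}
    (hU : IsCompactOpenBisection U) (hV : IsCompactOpenBisection V)
    (hf : O.SupportedOn f U) (hg : O.SupportedOn g V) :
    O.SupportedOn (O.conv f g) (ComposablePair.mul '' (ComposablePair.toProd ⁻¹' (U ×ˢ V))) := by
  have ho : IsOpen (ComposablePair.toProd ⁻¹' (U ×ˢ V) : Set (ComposablePair X)) :=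
    (hU.isOpen.prod hV.isOpen).preimage continuous_induced_dom
  constructor
  · rintro _ ⟨q, hq, rfl⟩
    apply ContinuousAt.continuousWithinAt
    rw [ContinuousAt, ← AmpleGroupoid.isOpenMap_mul.map_nhds_eq
      AmpleGroupoid.continuous_mul.continuousAt, Filter.tendsto_map'_iff]
    have key : ∀ q ∈ (ComposablePair.toProd ⁻¹' (U ×ˢ V) : Set (ComposablePair X)),
        O.conv f g q.mul =
          f ⟨q.y, q.z, q.outer⟩ * O.act q.outer (g ⟨q.x, q.y, q.inner⟩) := by
      rintro ⟨β, ρ⟩ hq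
      refine (O.conv_apply_of_unique f g β (hf.eq_zero_of_ne hU hq.1) (ρ ≫ β)).trans ?_
      have e : (ρ ≫ β) ≫ Groupoid.inv β = ρ := by simp
      rw [e]
    have h : ContinuousAt (fun q : ComposablePair X => (⟨q.z,
        f ⟨q.y, q.z, q.outer⟩ * O.act q.outer (g ⟨q.x, q.y, q.inner⟩)⟩ : Σ x, O.stalk x)) q := by
      have h1 : ContinuousAt (fun q : ComposablePair X =>
          (⟨q.z, f ⟨q.y, q.z, q.outer⟩⟩ : Σ x, O.stalk x)) q :=
        ContinuousAt.comp (g := fun γ : Quiver.Total X => (⟨γ.right, f γ⟩ : Σ x, O.stalk x))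
          (f := fun q : ComposablePair X => (⟨q.y, q.z, q.outer⟩ : Quiver.Total X))
          (hf.1.continuousAt (hU.isOpen.mem_nhds hq.1))
          AmpleGroupoid.continuous_outer.continuousAt
      have h2 : ContinuousAt (fun q : ComposablePair X =>
          (⟨q.y, g ⟨q.x, q.y, q.inner⟩⟩ : Σ x, O.stalk x)) q :=
        ContinuousAt.comp (g := fun γ : Quiver.Total X => (⟨γ.right, g γ⟩ : Σ x, O.stalk x))
          (f := fun q : ComposablePair X => (⟨q.x, q.y, q.inner⟩ : Quiver.Total X))
          (hg.1.continuousAt (hV.isOpen.mem_nhds hq.2))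
          AmpleGroupoid.continuous_inner.continuousAt
      have h3 : ContinuousAt (fun q : ComposablePair X =>
          (⟨⟨q.y, q.z, q.outer⟩, g ⟨q.x, q.y, q.inner⟩⟩ : ActionPair O.stalk)) q :=
        isInducing_actionPair.continuousAt_iff.2
          (AmpleGroupoid.continuous_outer.continuousAt.prodMk h2)
      have h4 := ContinuousAt.comp O.continuous_act.continuousAt h3
      have h5 : ContinuousAt (fun q : ComposablePair X => (⟨q.z, f ⟨q.y, q.z, q.outer⟩,
          O.act q.outer (g ⟨q.x, q.y, q.inner⟩)⟩ : FiberPair O.stalk)) q :=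
        isInducing_fiberPair.continuousAt_iff.2 (h1.prodMk h4)
      exact ContinuousAt.comp O.continuous_mul.continuousAt h5
    have h' := h.tendsto
    simp only [← key q hq] at h'
    refine h'.congr' ?_
    filter_upwards [ho.mem_nhds hq] with p hp
    simp only [← key p hp]
    rfl
  · rintro ⟨x, y, γ⟩ hγ
    obtain ⟨⟨z, δ⟩, hδ⟩ := hf.exists_unique hU y
    rw [O.conv_apply_of_unique f g δ hδ γ]
    by_cases h1 : (⟨z, y, δ⟩ : Quiver.Total X) ∈ U
    · by_cases h2 : (⟨x, z, γ ≫ Groupoid.inv δ⟩ : Quiver.Total X) ∈ V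
      · exact absurd ⟨⟨δ, γ ≫ Groupoid.inv δ⟩, ⟨h1, h2⟩, by simp [ComposablePair.mul]⟩ hγ
      · rw [hg.2 _ h2]; simp
    · rw [hf.2 _ h1]; simp

lemma conv_mem [AmpleGroupoid X] (O : GroupoidSheafOfRings.{w} X)
    {f g : ∀ γ : Quiver.Total X, O.stalk γ.right} (hf : f ∈ O.convAlgebra)
    (hg : g ∈ O.convAlgebra) : O.conv f g ∈ O.convAlgebra := by
  refine AddSubgroup.closure_induction₂ (p := fun f g _ _ => O.conv f g ∈ O.convAlgebra)
    ?_ ?_ ?_ ?_ ?_ ?_ ?_ hf hg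
  · rintro f g ⟨U, hU, -, hf⟩ ⟨V, hV, -, hg⟩
    exact AddSubgroup.subset_closure ⟨_, AmpleGroupoid.isCompactOpenBisection_mul hU hV,
      Set.subset_univ _, hf.conv hU hV hg⟩
  · intro g _; rw [zero_conv]; exact zero_mem _
  · intro f _; rw [conv_zero]; exact zero_mem _
  · intro f g h hf hg _ h1 h2; rw [O.add_conv hf hg]; exact add_mem h1 h2
  · intro g h f _ _ hf h1 h2; rw [O.conv_add hf]; exact add_mem h1 h2
  · intro f g _ _ h; rw [neg_conv]; exact neg_mem h
  · intro f g _ _ h; rw [conv_neg]; exact neg_mem h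

lemma conv_assoc [AmpleGroupoid X] (O : GroupoidSheafOfRings.{w} X)
    {f g : ∀ γ : Quiver.Total X, O.stalk γ.right} (hf : f ∈ O.convAlgebra)
    (hg : g ∈ O.convAlgebra) (h : ∀ γ : Quiver.Total X, O.stalk γ.right) :
    O.conv (O.conv f g) h = O.conv f (O.conv g h) := by
  induction hf using AddSubgroup.closure_induction with
  | mem f hf =>
    obtain ⟨U, hU, -, hf⟩ := hf
    funext ⟨x, y, γ⟩
    obtain ⟨⟨z, δ⟩, hδ⟩ := hf.exists_unique hU y
    rw [O.conv_apply_of_unique f _ δ hδ γ]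
    let e : (Σ t : X, t ⟶ z) ≃ (Σ t : X, t ⟶ y) :=
      { toFun := fun ε => ⟨ε.1, ε.2 ≫ δ⟩
        invFun := fun β => ⟨β.1, β.2 ≫ Groupoid.inv δ⟩
        left_inv := fun ε => by simp
        right_inv := fun β => by simp }
    have h1 : O.conv (O.conv f g) h ⟨x, y, γ⟩ = ∑ᶠ ε : Σ t : X, t ⟶ z,
        f ⟨z, y, δ⟩ * O.act δ (g ⟨ε.1, z, ε.2⟩ *
          O.act ε.2 (h ⟨x, ε.1, (γ ≫ Groupoid.inv δ) ≫ Groupoid.inv ε.2⟩)) := by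
      refine (finsum_comp_equiv e).symm.trans (finsum_congr fun ε => ?_)
      have h2 := O.conv_apply_of_unique f g δ hδ (ε.2 ≫ δ)
      change O.conv f g ⟨ε.1, y, ε.2 ≫ δ⟩ * O.act (ε.2 ≫ δ)
        (h ⟨x, ε.1, γ ≫ Groupoid.inv (ε.2 ≫ δ)⟩) = _
      have e1 : (ε.2 ≫ δ) ≫ Groupoid.inv δ = ε.2 := by simp
      have e2 : γ ≫ Groupoid.inv (ε.2 ≫ δ) =
          (γ ≫ Groupoid.inv δ) ≫ Groupoid.inv ε.2 := by simp [Groupoid.inv_eq_inv]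
      rw [h2, O.act_comp, map_mul, mul_assoc, e1, e2]
    rw [h1]
    have hfin := O.hasFiniteSupport_conv hg z fun ε =>
      O.act ε.2 (h ⟨x, ε.1, (γ ≫ Groupoid.inv δ) ≫ Groupoid.inv ε.2⟩)
    exact (((AddMonoidHom.mulLeft (f ⟨z, y, δ⟩)).comp
      (O.act δ).toAddMonoidHom).map_finsum hfin).symm
  | zero => simp only [zero_conv]
  | add f f' hf hf' h1 h2 =>
    rw [O.add_conv hf hf', O.add_conv (O.conv_mem hf hg) (O.conv_mem hf' hg), h1, h2,
      O.add_conv hf hf']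
  | neg f hf h1 => simp only [neg_conv, h1]

/-- `Γ_c(G, O)` is a ring under pointwise addition and convolution. -/
noncomputable instance [AmpleGroupoid X] (O : GroupoidSheafOfRings.{w} X) :
    NonUnitalRing O.convAlgebra where
  mul f g := ⟨O.conv f g, O.conv_mem f.2 g.2⟩
  left_distrib f g h := Subtype.ext (O.conv_add f.2 g h)
  right_distrib f g h := Subtype.ext (O.add_conv f.2 g.2 h)
  zero_mul f := Subtype.ext (O.zero_conv f)
  mul_zero f := Subtype.ext (O.conv_zero f)
  mul_assoc f g h := Subtype.ext (O.conv_assoc f.2 g.2 h)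

/-! ### The diagonal subring and the action of the compact open bisections -/

lemma isOpen_zero (O : GroupoidSheafOfRings.{w} X) : IsOpen {e : Σ x, O.stalk x | e.2 = 0} := by
  have h : Continuous fun e : Σ x, O.stalk x => (⟨e.1, e.2, e.2⟩ : FiberPair O.stalk) :=
    isInducing_fiberPair.continuous_iff.2 (continuous_id.prodMk continuous_id)
  have := O.isLocalHomeomorph_proj.isLocallyInjective.isOpen_eqLocus
    (O.continuous_add.comp h) continuous_id rfl
  convert this using 1
  ext ⟨x, a⟩
  simp

lemma continuous_zero (O : GroupoidSheafOfRings.{w} X) :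
    Continuous fun x : X => (⟨x, 0⟩ : Σ x, O.stalk x) := by
  refine continuous_def.2 fun W hW => ?_
  convert O.isLocalHomeomorph_proj.isOpenMap _ (hW.inter O.isOpen_zero) using 1
  ext x
  constructor
  · intro h
    exact ⟨⟨x, 0⟩, ⟨h, rfl⟩, rfl⟩
  · rintro ⟨⟨x, a⟩, ⟨h, h'⟩, rfl⟩
    obtain rfl : a = 0 := h'
    exact h

lemma continuous_neg (O : GroupoidSheafOfRings.{w} X) :
    Continuous fun e : Σ x, O.stalk x => (⟨e.1, -e.2⟩ : Σ x, O.stalk x) := by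
  refine continuous_def.2 fun W hW => ?_
  have ho : IsOpenMap fun q : FiberPair O.stalk => q.toProd.1 :=
    isOpenMap_fst_of_pullback isInducing_fiberPair
      O.isLocalHomeomorph_proj.continuous O.isLocalHomeomorph_proj.isOpenMap
      (by
        rintro ⟨x, a⟩ ⟨y, b⟩ h
        obtain rfl : x = y := h
        exact ⟨⟨x, a, b⟩, rfl⟩)
      (fun _ => rfl)
  convert ho _ ((O.isOpen_zero.preimage O.continuous_add).inter
    (hW.preimage (continuous_snd.comp isInducing_fiberPair.continuous))) using 1
  ext ⟨x, a⟩
  constructor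
  · intro h
    exact ⟨⟨x, a, -a⟩, ⟨by simp, h⟩, rfl⟩
  · rintro ⟨⟨y, b, c⟩, ⟨h, h'⟩, heq⟩
    obtain ⟨rfl, heq⟩ := Sigma.mk.inj heq
    obtain rfl := eq_of_heq heq
    obtain rfl : c = -b := (neg_eq_of_add_eq_zero_right h).symm
    exact h'

lemma isClosed_support (O : GroupoidSheafOfRings.{w} X) {s : ∀ x, O.stalk x}
    (hs : Continuous fun x => (⟨x, s x⟩ : Σ x, O.stalk x)) : IsClosed {x | s x ≠ 0} :=
  (O.isOpen_zero.preimage hs).isClosed_compl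

/-- The ring `Γ_c(G⁰, O)` of continuous sections with compact support over the unit space, with
pointwise operations. (The support of a continuous section is closed.) -/
def diagonal (O : GroupoidSheafOfRings.{w} X) : NonUnitalSubring (∀ x, O.stalk x) where
  carrier := {s | Continuous (fun x => (⟨x, s x⟩ : Σ x, O.stalk x)) ∧ IsCompact {x | s x ≠ 0}}
  zero_mem' := ⟨O.continuous_zero, by simp⟩
  add_mem' {s t} hs ht := by
    have h : Continuous fun x => (⟨x, (s + t) x⟩ : Σ x, O.stalk x) :=
      O.continuous_add.comp (f := fun x => (⟨x, s x, t x⟩ : FiberPair O.stalk))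
        (isInducing_fiberPair.continuous_iff.2 (hs.1.prodMk ht.1))
    refine ⟨h, (hs.2.union ht.2).of_isClosed_subset (O.isClosed_support h) ?_⟩
    intro x hx
    by_contra hx'
    simp only [Set.mem_union, Set.mem_ofPred_eq, not_or, not_not] at hx'
    exact hx (by simp [hx'.1, hx'.2])
  mul_mem' {s t} hs ht := by
    have h : Continuous fun x => (⟨x, (s * t) x⟩ : Σ x, O.stalk x) :=
      O.continuous_mul.comp (f := fun x => (⟨x, s x, t x⟩ : FiberPair O.stalk))
        (isInducing_fiberPair.continuous_iff.2 (hs.1.prodMk ht.1))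
    refine ⟨h, hs.2.of_isClosed_subset (O.isClosed_support h) ?_⟩
    intro x hx hx'
    exact hx (by simp [hx'])
  neg_mem' {s} hs := by
    refine ⟨O.continuous_neg.comp hs.1, ?_⟩
    simpa using hs.2

/-- Extension by zero of a section over the unit space to the arrow space. -/
noncomputable def extendByZero (O : GroupoidSheafOfRings.{w} X) (s : ∀ x, O.stalk x)
    (γ : Quiver.Total X) : O.stalk γ.right :=
  open Classical in if γ ∈ unitArrows X then s γ.right else 0

lemma exists_isCompact_isOpen_superset [AmpleGroupoid X] {K : Set X} (hK : IsCompact K) :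
    ∃ U : Set X, IsOpen U ∧ IsCompact U ∧ K ⊆ U := by
  refine hK.induction_on (p := fun K => ∃ U : Set X, IsOpen U ∧ IsCompact U ∧ K ⊆ U)
    ?_ ?_ ?_ ?_
  · exact ⟨∅, isOpen_empty, isCompact_empty, subset_rfl⟩
  · rintro s t hst ⟨U, h1, h2, h3⟩
    exact ⟨U, h1, h2, hst.trans h3⟩
  · rintro s t ⟨U, h1, h2, h3⟩ ⟨V, h1', h2', h3'⟩
    exact ⟨U ∪ V, h1.union h1', h2.union h2', Set.union_subset_union h3 h3'⟩
  · intro x _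
    obtain ⟨U, ⟨h1, h2⟩, h3, -⟩ := (AmpleGroupoid.isTopologicalBasis (X := X)).mem_nhds_iff.1
      (Filter.univ_mem (f := 𝓝 x))
    exact ⟨U, mem_nhdsWithin_of_mem_nhds (h1.mem_nhds h3), U, h1, h2, subset_rfl⟩

lemma extendByZero_mem [AmpleGroupoid X] (O : GroupoidSheafOfRings.{w} X) {s : ∀ x, O.stalk x}
    (hs : s ∈ O.diagonal) : O.extendByZero s ∈ O.convAlgebra := by
  obtain ⟨V, hV, hVc, hsV⟩ := exists_isCompact_isOpen_superset hs.2
  refine AddSubgroup.subset_closure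
    ⟨(fun x : X => (⟨x, x, 𝟙 x⟩ : Quiver.Total X)) '' V, ⟨?_, ?_, ?_, ?_⟩, Set.subset_univ _, ?_, ?_⟩
  · convert (AmpleGroupoid.isOpen_unitArrows (X := X)).inter
      (hV.preimage AmpleGroupoid.continuous_range) using 1
    ext γ
    constructor
    · rintro ⟨x, hx, rfl⟩
      exact ⟨⟨x, rfl⟩, hx⟩
    · rintro ⟨⟨x, rfl⟩, hx⟩
      exact ⟨x, hx, rfl⟩
  · exact hVc.image AmpleGroupoid.continuous_unit
  · rintro _ ⟨x, -, rfl⟩ _ ⟨y, -, rfl⟩ h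
    obtain rfl : x = y := h
    rfl
  · rintro _ ⟨x, -, rfl⟩ _ ⟨y, -, rfl⟩ h
    obtain rfl : x = y := h
    rfl
  · refine ((hs.1.comp AmpleGroupoid.continuous_range).continuousOn).congr ?_
    rintro _ ⟨x, -, rfl⟩
    have : (⟨x, x, 𝟙 x⟩ : Quiver.Total X) ∈ unitArrows X := ⟨x, rfl⟩
    simp [extendByZero, this]
  · intro γ hγ
    unfold extendByZero
    split_ifs with h
    · obtain ⟨x, rfl⟩ := h
      by_contra hx
      exact hγ ⟨x, hsV hx, rfl⟩
    · rfl

lemma extendByZero_mul (O : GroupoidSheafOfRings.{w} X) (s t : ∀ x, O.stalk x) :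
    O.extendByZero (s * t) = O.conv (O.extendByZero s) (O.extendByZero t) := by
  funext ⟨x, y, γ⟩
  rw [O.conv_apply_of_unique _ _ (𝟙 y) ?_ γ]
  · have h1 : (⟨y, y, 𝟙 y⟩ : Quiver.Total X) ∈ unitArrows X := ⟨y, rfl⟩
    have h2 : γ ≫ Groupoid.inv (𝟙 y) = γ := by simp [Groupoid.inv_eq_inv]
    rw [h2, O.act_id]
    by_cases h : (⟨x, y, γ⟩ : Quiver.Total X) ∈ unitArrows X <;> simp [extendByZero, h, h1]
  · rintro ⟨z, β⟩ hβ
    refine if_neg ?_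
    rintro ⟨z', h⟩
    simp only [Quiver.Total.mk.injEq] at h
    obtain ⟨rfl, rfl, h⟩ := h
    exact hβ (by rw [eq_of_heq h])

/-- The embedding of `Γ_c(G⁰, O)` in `Γ_c(G, O)`, by extension by zero. -/
noncomputable def diagonalEmbedding [AmpleGroupoid X] (O : GroupoidSheafOfRings.{w} X) :
    O.diagonal →ₙ+* O.convAlgebra where
  toFun s := ⟨O.extendByZero s, O.extendByZero_mem s.2⟩
  map_mul' s t := Subtype.ext (O.extendByZero_mul s t)
  map_zero' := Subtype.ext (by funext γ; simp [extendByZero])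
  map_add' s t := Subtype.ext (by
    funext γ
    by_cases h : γ ∈ unitArrows X <;> simp [extendByZero, h])

/-- `Γ_c(G⁰, O)` is a maximal commutative subring of `Γ_c(G, O)`. -/
def IsDiagonalMaximalCommutative [AmpleGroupoid X] (O : GroupoidSheafOfRings.{w} X) : Prop :=
  Maximal (fun S : NonUnitalSubring O.convAlgebra => ∀ a ∈ S, ∀ b ∈ S, a * b = b * a)
    (NonUnitalRingHom.range O.diagonalEmbedding)

/-- For a bisection `U`, the section whose value at the range of `γ ∈ U` is the image under `γ` of
the value of `s` at the source of `γ`, and which vanishes outside of the range of `U`. -/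
noncomputable def transport (O : GroupoidSheafOfRings.{w} X) (U : Set (Quiver.Total X))
    (s : ∀ x, O.stalk x) (x : X) : O.stalk x :=
  open Classical in
  if h : ∃ γ ∈ U, γ.right = x then
    h.choose_spec.2 ▸ O.act h.choose.hom (s h.choose.left)
  else 0

lemma transport_apply (O : GroupoidSheafOfRings.{w} X) {U : Set (Quiver.Total X)}
    (hU : IsCompactOpenBisection U) (s : ∀ x, O.stalk x) {γ : Quiver.Total X} (hγ : γ ∈ U) :
    O.transport U s γ.right = O.act γ.hom (s γ.left) := by
  have h : ∃ γ' ∈ U, γ'.right = γ.right := ⟨γ, hγ, rfl⟩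
  have key : ∀ γ' (_ : γ' ∈ U) (e : γ'.right = γ.right),
      (e ▸ O.act γ'.hom (s γ'.left) : O.stalk γ.right) = O.act γ.hom (s γ.left) := by
    intro γ' h' e
    obtain rfl := hU.range_injOn h' hγ e
    rfl
  rw [transport, dif_pos h]
  exact key _ h.choose_spec.1 h.choose_spec.2

lemma transport_eq_zero (O : GroupoidSheafOfRings.{w} X) {U : Set (Quiver.Total X)}
    (s : ∀ x, O.stalk x) {x : X} (hx : ¬ ∃ γ ∈ U, γ.right = x) : O.transport U s x = 0 :=
  dif_neg hx

lemma transport_mem [AmpleGroupoid X] (O : GroupoidSheafOfRings.{w} X)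
    {U : Set (Quiver.Total X)} (hU : IsCompactOpenBisection U) {s : ∀ x, O.stalk x}
    (hs : s ∈ O.diagonal) : O.transport U s ∈ O.diagonal := by
  have := AmpleGroupoid.t2 (X := X)
  have hc : IsCompact ((fun γ : Quiver.Total X => γ.right) '' U) :=
    hU.isCompact.image AmpleGroupoid.continuous_range
  have h : Continuous fun x => (⟨x, O.transport U s x⟩ : Σ x, O.stalk x) := by
    rw [continuous_iff_continuousAt]
    intro x
    by_cases hx : x ∈ (fun γ : Quiver.Total X => γ.right) '' U
    · obtain ⟨γ, hγ, rfl⟩ := hx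
      rw [ContinuousAt, ← AmpleGroupoid.isLocalHomeomorph_range.map_nhds_eq γ,
        Filter.tendsto_map'_iff]
      have h1 : Continuous fun γ : Quiver.Total X => (⟨γ, s γ.left⟩ : ActionPair O.stalk) :=
        isInducing_actionPair.continuous_iff.2
          (continuous_id.prodMk (hs.1.comp AmpleGroupoid.continuous_source))
      have h2 := ((O.continuous_act.comp h1).continuousAt (x := γ)).tendsto
      simp only [Function.comp_apply, ← O.transport_apply hU s hγ] at h2
      refine h2.congr' ?_
      filter_upwards [hU.isOpen.mem_nhds hγ] with γ' hγ'
      simp only [Function.comp_apply, O.transport_apply hU s hγ']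
    · refine O.continuous_zero.continuousAt.congr ?_
      filter_upwards [hc.isClosed.isOpen_compl.mem_nhds hx] with y hy
      rw [O.transport_eq_zero s hy]
  refine ⟨h, hc.of_isClosed_subset (O.isClosed_support h) ?_⟩
  intro x hx
  by_contra hx'
  exact hx (O.transport_eq_zero s hx')

/-- An ideal `I` of `Γ_c(G⁰, O)` is invariant if, for every compact open bisection `U`, the
isomorphism `D_{U⁻¹} → D_U` defined by `U` maps `I ∩ D_{U⁻¹}` into `I`; here `D_{U⁻¹}` and `D_U` are
the ideals of the sections vanishing outside of the source and the range of `U`. -/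
def IsInvariantIdeal [AmpleGroupoid X] (O : GroupoidSheafOfRings.{w} X)
    (I : TwoSidedIdeal O.diagonal) : Prop :=
  ∀ (U : Set (Quiver.Total X)) (hU : IsCompactOpenBisection U), ∀ s ∈ I,
    (∀ x, s.1 x ≠ 0 → ∃ γ ∈ U, γ.left = x) →
      (⟨O.transport U s.1, O.transport_mem hU s.2⟩ : O.diagonal) ∈ I

/-- `Γ_c(G⁰, O)` is simple for the action of the inverse semigroup of compact open bisections. -/
def IsDiagonalSimple [AmpleGroupoid X] (O : GroupoidSheafOfRings.{w} X) : Prop :=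
  ∀ I : TwoSidedIdeal O.diagonal, O.IsInvariantIdeal I → I = ⊥ ∨ I = ⊤

end GroupoidSheafOfRings

/-!
Simplicity of the convolution algebra is compared with properties of the diagonal
`Γ_c(G⁰, O)` in two independent ways.

Ideals: an invariant ideal `I` of the diagonal is determined by its stalks `I_x = {s(x) : s ∈ I}`,
which the arrows permute, so the functions with values in the `I_x` form an ideal of the convolution
algebra that meets the diagonal exactly in `I`. Conversely, conjugation by the characteristic
function of a bisection shows that the trace on the diagonal of an ideal of the convolution algebra
is invariant. When the stalks are fields, each `I_x` is `0` or everything, and the units `x` with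
`I_x` everything form an open invariant set.

Centralizers: summation over the arrows with a given range retracts the convolution algebra onto
the diagonal and makes the diagonal a left module. If `f` centralizes the diagonal, then `f` minus
its retraction annihilates this module, hence vanishes when the algebra is simple: the diagonal is
then its own centralizer. Conversely, suppose that it is and let `f ≠ 0` belong to an ideal `J`,
with support covered by `n` bisections. After multiplication by the characteristic function of the
inverse of one of them, this bisection consists of units. If the product centralizes the diagonal,
it is a nonzero element of the diagonal in `J`; otherwise, some commutator with the diagonal is
a nonzero element of `J` that vanishes on the units, so `n - 1` bisections suffice to cover its
support. Finally, over integral domains, centralizing the diagonal means being supported in the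
kernel of `O`, and over fields the supports are open as soon as the arrow space is Hausdorff.
-/

lemma exists_isOpen_isCompact_injOn {Y Z : Type*} [TopologicalSpace Y] [TopologicalSpace Z]
    {f : Y → Z} (hf : IsLocalHomeomorph f)
    (hZ : IsTopologicalBasis {K : Set Z | IsOpen K ∧ IsCompact K}) {y : Y} {V : Set Y}
    (hV : IsOpen V) (hy : y ∈ V) :
    ∃ U, IsOpen U ∧ IsCompact U ∧ Set.InjOn f U ∧ y ∈ U ∧ U ⊆ V := by
  obtain ⟨e, hye, rfl⟩ := hf y
  have hy' : y ∈ (e.restrOpen V hV).source := ⟨hye, hy⟩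
  obtain ⟨K, ⟨hKo, hKc⟩, hyK, hK⟩ :=
    hZ.exists_subset_of_mem_open ((e.restrOpen V hV).map_source hy') (e.restrOpen V hV).open_target
  have hsource : (e.restrOpen V hV).symm '' K ⊆ e.source ∩ V :=
    ((e.restrOpen V hV).symm.mapsTo.mono_left hK).image_subset
  exact ⟨(e.restrOpen V hV).symm '' K,
    (e.restrOpen V hV).symm.isOpen_image_of_subset_source hKo hK,
    hKc.image_of_continuousOn ((e.restrOpen V hV).continuousOn_symm.mono hK),
    e.injOn.mono fun _ h => (hsource h).1,
    ⟨_, hyK, (e.restrOpen V hV).left_inv hy'⟩, fun _ h => (hsource h).2⟩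

lemma maximal_commutative_iff_centralizer_eq {R : Type*} [NonUnitalRing R]
    {S : NonUnitalSubring R} :
    Maximal (fun T : NonUnitalSubring R => ∀ a ∈ T, ∀ b ∈ T, a * b = b * a) S ↔
      NonUnitalSubring.centralizer (S : Set R) = S := by
  constructor
  · intro hS
    refine le_antisymm (fun z hz => ?_)
      fun a ha => NonUnitalSubring.mem_centralizer_iff.2 fun b hb => hS.prop b hb a ha
    have hcomm : ∀ a ∈ insert z (S : Set R), ∀ b ∈ insert z (S : Set R), a * b = b * a := by
      rintro a (rfl | ha) b (rfl | hb)
      · rfl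
      · exact (NonUnitalSubring.mem_centralizer_iff.1 hz b hb).symm
      · exact NonUnitalSubring.mem_centralizer_iff.1 hz a ha
      · exact hS.prop a ha b hb
    have := NonUnitalSubring.isMulCommutative_closure hcomm
    exact hS.le_of_ge (y := NonUnitalSubring.closure (insert z (S : Set R)))
      (fun a ha b hb => setLike_mul_comm ha hb)
      (fun a ha => NonUnitalSubring.subset_closure (Set.mem_insert_of_mem z ha))
      (NonUnitalSubring.subset_closure (Set.mem_insert z _))
  · intro hS
    have hmem {z : R} : z ∈ S ↔ ∀ a ∈ S, a * z = z * a :=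
      (SetLike.ext_iff.1 hS z).symm.trans NonUnitalSubring.mem_centralizer_iff
    exact ⟨fun a ha b hb => hmem.1 hb a ha,
      fun T hT hST z hz => hmem.2 fun a ha => hT a (hST ha) z hz⟩

section Indicator

variable {ι : Type*} {R : ι → Type*}

/-- The characteristic function of a set of indices, in a product of rings. -/
noncomputable def indicatorOne [∀ i, Zero (R i)] [∀ i, One (R i)] (s : Set ι) : ∀ i, R i :=
  open Classical in s.piecewise 1 0

lemma indicatorOne_of_mem [∀ i, Zero (R i)] [∀ i, One (R i)] {s : Set ι} {i : ι} (hi : i ∈ s) :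
    indicatorOne (R := R) s i = 1 := by
  classical exact Set.piecewise_eq_of_mem _ _ _ hi

lemma indicatorOne_of_notMem [∀ i, Zero (R i)] [∀ i, One (R i)] {s : Set ι} {i : ι}
    (hi : i ∉ s) : indicatorOne (R := R) s i = 0 := by
  classical exact Set.piecewise_eq_of_notMem _ _ _ hi

end Indicator

section Arrows

variable {X : Type u} [Groupoid.{v} X]

lemma unit_mem_unitArrows (x : X) : (⟨x, x, 𝟙 x⟩ : Quiver.Total X) ∈ unitArrows X := ⟨x, rfl⟩

/-- The inverse of an arrow, as a map of the arrow space. -/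
def invArrow (γ : Quiver.Total X) : Quiver.Total X :=
  ⟨γ.right, γ.left, Groupoid.inv γ.hom⟩

lemma invArrow_involutive : Function.Involutive (invArrow (X := X)) := fun γ => by
  simp [invArrow, Groupoid.inv_eq_inv]

/-- The set of products of an arrow in `U` and an arrow in `V`. -/
def mulArrows (U V : Set (Quiver.Total X)) : Set (Quiver.Total X) :=
  ComposablePair.mul '' (ComposablePair.toProd ⁻¹' (U ×ˢ V))

lemma mulArrows_mono {U U' V V' : Set (Quiver.Total X)} (hU : U ⊆ U') (hV : V ⊆ V') :
    mulArrows U V ⊆ mulArrows U' V' :=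
  Set.image_mono (Set.preimage_mono (Set.prod_mono hU hV))

lemma range_fiber_injective (y : X) :
    Function.Injective fun β : Σ z : X, z ⟶ y => (⟨β.1, y, β.2⟩ : Quiver.Total X) := by
  rintro ⟨z, β⟩ ⟨z', β'⟩ h
  cases h
  rfl

variable [TopologicalSpace (Quiver.Total X)]

lemma IsCompactOpenBisection.mulArrows_inv_subset {U : Set (Quiver.Total X)}
    (hU : IsCompactOpenBisection U) : mulArrows U (invArrow ⁻¹' U) ⊆ unitArrows X := by
  rintro _ ⟨@⟨x, y, z, β, ρ⟩, ⟨hβ, hρ⟩, rfl⟩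
  have h : (⟨y, z, β⟩ : Quiver.Total X) = ⟨y, x, Groupoid.inv ρ⟩ := hU.source_injOn hβ hρ rfl
  cases h
  exact ⟨x, by simp [ComposablePair.mul]⟩

namespace AmpleGroupoid

variable [TopologicalSpace X] [AmpleGroupoid X]

/-- Inversion, as a self-homeomorphism of the arrow space. -/
def invHomeomorph : Quiver.Total X ≃ₜ Quiver.Total X where
  toEquiv := invArrow_involutive.toPerm
  continuous_toFun := continuous_inv
  continuous_invFun := continuous_inv

lemma isCompactOpenBisection_inv {U : Set (Quiver.Total X)} (hU : IsCompactOpenBisection U) :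
    IsCompactOpenBisection (invArrow ⁻¹' U) where
  isOpen := hU.isOpen.preimage continuous_inv
  isCompact := invHomeomorph.isCompact_preimage.2 hU.isCompact
  source_injOn := hU.range_injOn.comp invArrow_involutive.injective.injOn (Set.mapsTo_preimage _ _)
  range_injOn := hU.source_injOn.comp invArrow_involutive.injective.injOn (Set.mapsTo_preimage _ _)

lemma isLocalHomeomorph_source : IsLocalHomeomorph fun γ : Quiver.Total X => γ.left :=
  isLocalHomeomorph_range.comp invHomeomorph.isLocalHomeomorph

lemma exists_isCompactOpenBisection {γ : Quiver.Total X} {V : Set (Quiver.Total X)}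
    (hV : IsOpen V) (hγ : γ ∈ V) : ∃ U, IsCompactOpenBisection U ∧ γ ∈ U ∧ U ⊆ V := by
  obtain ⟨W, hW, hγW, hinj⟩ := (isLocalHomeomorph_source (X := X)).isLocallyInjective γ
  obtain ⟨U, hUo, hUc, hUinj, hγU, hUV⟩ := exists_isOpen_isCompact_injOn
    isLocalHomeomorph_range isTopologicalBasis (hV.inter hW) ⟨hγ, hγW⟩
  exact ⟨U, ⟨hUo, hUc, hinj.mono fun _ h => (hUV h).2, hUinj⟩, hγU, fun _ h => (hUV h).1⟩

lemma isCompactOpenBisection_unit_image {W : Set X} (hWo : IsOpen W) (hWc : IsCompact W) :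
    IsCompactOpenBisection ((fun x : X => (⟨x, x, 𝟙 x⟩ : Quiver.Total X)) '' W) where
  isOpen := by
    convert (isOpen_unitArrows (X := X)).inter (hWo.preimage continuous_range) using 1
    ext γ
    constructor
    · rintro ⟨x, hx, rfl⟩
      exact ⟨⟨x, rfl⟩, hx⟩
    · rintro ⟨⟨x, rfl⟩, hx⟩
      exact ⟨x, hx, rfl⟩
  isCompact := hWc.image continuous_unit
  source_injOn := by
    rintro _ ⟨x, -, rfl⟩ _ ⟨y, -, rfl⟩ (rfl : x = y)
    rfl
  range_injOn := by
    rintro _ ⟨x, -, rfl⟩ _ ⟨y, -, rfl⟩ (rfl : x = y)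
    rfl

end AmpleGroupoid

end Arrows

namespace GroupoidSheafOfRings

variable {X : Type u} [Groupoid.{v} X] [TopologicalSpace X] [TopologicalSpace (Quiver.Total X)]

section Diagonal

variable (O : GroupoidSheafOfRings.{w} X)

lemma isOpen_setOf_apply_eq {s t : ∀ x, O.stalk x}
    (hs : Continuous fun x => (⟨x, s x⟩ : Σ x, O.stalk x))
    (ht : Continuous fun x => (⟨x, t x⟩ : Σ x, O.stalk x)) : IsOpen {x | s x = t x} := by
  convert O.isLocalHomeomorph_proj.isLocallyInjective.isOpen_eqLocus hs ht rfl using 1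
  ext x
  simp

lemma isOpen_setOf_exists_mul_eq_one : IsOpen {e : Σ x, O.stalk x | ∃ b, e.2 * b = 1} := by
  have hpt : Continuous fun q : FiberPair O.stalk => q.pt :=
    O.isLocalHomeomorph_proj.continuous.comp (continuous_fst.comp isInducing_fiberPair.continuous)
  have hfst : IsOpenMap fun q : FiberPair O.stalk => q.toProd.1 :=
    isOpenMap_fst_of_pullback isInducing_fiberPair
      O.isLocalHomeomorph_proj.continuous O.isLocalHomeomorph_proj.isOpenMap
      (by rintro ⟨x, a⟩ ⟨y, b⟩ (rfl : x = y); exact ⟨⟨x, a, b⟩, rfl⟩) fun _ => rfl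
  convert hfst _ (O.isLocalHomeomorph_proj.isLocallyInjective.isOpen_eqLocus
    O.continuous_mul (O.continuous_one.comp hpt) rfl) using 1
  ext ⟨x, a⟩
  constructor
  · rintro ⟨b, hb⟩
    exact ⟨⟨x, a, b⟩, Sigma.ext rfl (heq_of_eq hb), rfl⟩
  · rintro ⟨⟨y, a, b⟩, hab, heq⟩
    cases heq
    exact ⟨b, eq_of_heq (Sigma.mk.inj hab).2⟩

lemma mem_diagonal_of_continuousOn [T2Space X] {Y : Type*} [TopologicalSpace Y] {q : Y → X}
    (hq : IsLocalHomeomorph q) {U : Set Y} (hUo : IsOpen U) (hUc : IsCompact U)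
    {s : ∀ x, O.stalk x} (hs : ContinuousOn (fun y => (⟨q y, s (q y)⟩ : Σ x, O.stalk x)) U)
    (hs0 : ∀ x ∉ q '' U, s x = 0) : s ∈ O.diagonal := by
  have hqU : IsCompact (q '' U) := hUc.image hq.continuous
  have hcont : Continuous fun x => (⟨x, s x⟩ : Σ x, O.stalk x) := by
    refine continuous_iff_continuousAt.2 fun x => ?_
    by_cases hx : x ∈ q '' U
    · obtain ⟨y, hy, rfl⟩ := hx
      rw [ContinuousAt, ← hq.map_nhds_eq y, Filter.tendsto_map'_iff]
      exact hs.continuousAt (hUo.mem_nhds hy)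
    · refine O.continuous_zero.continuousAt.congr ?_
      filter_upwards [hqU.isClosed.isOpen_compl.mem_nhds hx] with z hz
      rw [hs0 z hz]
  exact ⟨hcont, hqU.of_isClosed_subset (O.isClosed_support hcont)
    fun x hx => by_contra fun h => hx (hs0 x h)⟩

lemma indicatorOne_mem_diagonal [T2Space X] {W : Set X} (hWo : IsOpen W) (hWc : IsCompact W) :
    indicatorOne W ∈ O.diagonal := by
  refine O.mem_diagonal_of_continuousOn (Homeomorph.refl X).isLocalHomeomorph hWo hWc ?_ ?_
  · refine O.continuous_one.continuousOn.congr fun x hx => ?_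
    exact Sigma.ext rfl (heq_of_eq (indicatorOne_of_mem hx))
  · simpa using fun x hx => indicatorOne_of_notMem hx

variable [AmpleGroupoid X]

lemma exists_mem_diagonal_apply_eq {V : Set X} (hV : IsOpen V) {x : X} (hx : x ∈ V)
    (a : O.stalk x) : ∃ s ∈ O.diagonal, s x = a ∧ ∀ y ∉ V, s y = 0 := by
  have := AmpleGroupoid.t2 (X := X)
  obtain ⟨U, hUo, hUc, hinj, hxU, hUV⟩ := exists_isOpen_isCompact_injOn O.isLocalHomeomorph_proj
    AmpleGroupoid.isTopologicalBasis (hV.preimage O.isLocalHomeomorph_proj.continuous)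
    (y := ⟨x, a⟩) hx
  have hsection : ∀ y, ∃ b : O.stalk y,
      (∀ c, ⟨y, c⟩ ∈ U → b = c) ∧ (y ∉ Sigma.fst '' U → b = 0) := by
    intro y
    by_cases hy : y ∈ Sigma.fst '' U
    · obtain ⟨⟨y, b⟩, hb, rfl⟩ := hy
      exact ⟨b, fun c hc => eq_of_heq (Sigma.mk.inj (hinj hb hc rfl)).2,
        fun h => absurd ⟨_, hb, rfl⟩ h⟩
    · exact ⟨0, fun c hc => absurd ⟨_, hc, rfl⟩ hy, fun _ => rfl⟩
  choose s hsU hs0 using hsection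
  refine ⟨s, O.mem_diagonal_of_continuousOn O.isLocalHomeomorph_proj hUo hUc ?_ hs0,
    hsU x a hxU, fun y hy => hs0 y ?_⟩
  · refine continuousOn_id.congr fun e he => ?_
    rw [hsU e.1 e.2 he, id]
  · rintro ⟨e, he, rfl⟩
    exact hy (hUV he)

end Diagonal

section Convolution

variable (O : GroupoidSheafOfRings.{w} X)

lemma extendByZero_unit (s : ∀ x, O.stalk x) (x : X) : O.extendByZero s ⟨x, x, 𝟙 x⟩ = s x :=
  if_pos (unit_mem_unitArrows x)

lemma extendByZero_of_notMem (s : ∀ x, O.stalk x) {γ : Quiver.Total X} (hγ : γ ∉ unitArrows X) :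
    O.extendByZero s γ = 0 :=
  if_neg hγ

lemma supp_extendByZero_subset (s : ∀ x, O.stalk x) :
    O.supp (O.extendByZero s) ⊆ unitArrows X :=
  fun _ hγ => by_contra fun h => hγ (O.extendByZero_of_notMem s h)

lemma supp_indicatorOne_subset {U : Set (Quiver.Total X)} : O.supp (indicatorOne U) ⊆ U :=
  fun _ hγ => by_contra fun h => hγ (indicatorOne_of_notMem h)

lemma extendByZero_conv (s : ∀ x, O.stalk x) (f : ∀ γ : Quiver.Total X, O.stalk γ.right)
    (γ : Quiver.Total X) : O.conv (O.extendByZero s) f γ = s γ.right * f γ := by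
  obtain ⟨x, y, γ⟩ := γ
  rw [O.conv_apply_of_unique _ f (𝟙 y) ?_ γ, O.extendByZero_unit, O.act_id]
  · rw [Groupoid.inv_eq_inv, IsIso.inv_id, Category.comp_id]
  · intro β hβ
    refine O.extendByZero_of_notMem s ?_
    rintro ⟨z, h⟩
    obtain rfl : z = y := congrArg Quiver.Total.right h
    exact hβ (range_fiber_injective z h).symm

lemma conv_extendByZero (f : ∀ γ : Quiver.Total X, O.stalk γ.right) (s : ∀ x, O.stalk x)
    (γ : Quiver.Total X) : O.conv f (O.extendByZero s) γ = f γ * O.act γ.hom (s γ.left) := by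
  obtain ⟨x, y, γ⟩ := γ
  refine (finsum_eq_single _ (⟨x, γ⟩ : Σ z : X, z ⟶ y) ?_).trans ?_
  · rintro ⟨z, β⟩ hβ
    rw [O.extendByZero_of_notMem s, map_zero, mul_zero]
    rintro ⟨z', h⟩
    obtain rfl : z' = x := congrArg Quiver.Total.left h
    obtain rfl : z' = z := congrArg Quiver.Total.right h
    have hγβ : 𝟙 z' = γ ≫ Groupoid.inv β := by injection h
    have hβγ : γ = β := by
      rw [← Category.id_comp β, hγβ, Category.assoc, Groupoid.inv_comp, Category.comp_id]
    exact hβ (by rw [hβγ])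
  · rw [Groupoid.comp_inv, O.extendByZero_unit]

lemma supp_conv_subset (f g : ∀ γ : Quiver.Total X, O.stalk γ.right) :
    O.supp (O.conv f g) ⊆ mulArrows (O.supp f) (O.supp g) := by
  rintro ⟨x, y, γ⟩ hγ
  obtain ⟨⟨z, β⟩, hβ⟩ := not_forall.1 (mt finsum_eq_zero_of_forall_eq_zero hγ)
  refine ⟨⟨β, γ ≫ Groupoid.inv β⟩, ⟨left_ne_zero_of_mul hβ, fun h => ?_⟩, ?_⟩
  · exact right_ne_zero_of_mul hβ ((congrArg (O.act β) h).trans (map_zero _))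
  · simp [ComposablePair.mul]

lemma conv_indicatorOne_inv_unit {U : Set (Quiver.Total X)} (hU : IsCompactOpenBisection U)
    (f : ∀ γ : Quiver.Total X, O.stalk γ.right) {γ : Quiver.Total X} (hγ : γ ∈ U) :
    O.conv f (indicatorOne (invArrow ⁻¹' U)) ⟨γ.right, γ.right, 𝟙 γ.right⟩ = f γ := by
  obtain ⟨x, y, γ⟩ := γ
  refine (finsum_eq_single _ (⟨x, γ⟩ : Σ z : X, z ⟶ y) ?_).trans ?_
  · intro β hβ
    rw [indicatorOne_of_notMem, map_zero, mul_zero]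
    intro h
    have hβU : (⟨β.1, y, β.2⟩ : Quiver.Total X) ∈ U := by
      simpa [invArrow, Groupoid.inv_eq_inv] using h
    exact hβ (range_fiber_injective y (hU.range_injOn hβU hγ rfl))
  · rw [indicatorOne_of_mem, map_one, mul_one]
    simpa [invArrow, Groupoid.inv_eq_inv] using hγ

variable {O}

lemma exists_finset_bisection_cover {H : Set (Quiver.Total X)}
    {f : ∀ γ : Quiver.Total X, O.stalk γ.right} (hf : f ∈ O.sectionsIn H) :
    ∃ t : Finset (Set (Quiver.Total X)),
      (∀ U ∈ t, IsCompactOpenBisection U ∧ U ⊆ H) ∧ O.supp f ⊆ ⋃ U ∈ t, U := by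
  classical
  induction hf using AddSubgroup.closure_induction with
  | mem f hf =>
    obtain ⟨U, hU, hUH, hfU⟩ := hf
    exact ⟨{U}, by simp [hU, hUH], fun γ hγ => by simpa using by_contra fun h => hγ (hfU.2 γ h)⟩
  | zero => exact ⟨∅, by simp, fun γ hγ => absurd rfl hγ⟩
  | add f g _ _ hf hg =>
    obtain ⟨t, ht, hft⟩ := hf
    obtain ⟨t', ht', hgt⟩ := hg
    refine ⟨t ∪ t', fun U hU => (Finset.mem_union.1 hU).elim (ht U) (ht' U), fun γ hγ => ?_⟩
    rw [Finset.set_biUnion_union]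
    by_contra h
    rw [Set.mem_union, not_or] at h
    exact hγ (by
      rw [Pi.add_apply, not_not.1 fun h' => h.1 (hft h'), not_not.1 fun h' => h.2 (hgt h'),
        add_zero])
  | neg f _ hf =>
    obtain ⟨t, ht, hft⟩ := hf
    exact ⟨t, ht, fun γ hγ => hft (neg_ne_zero.1 hγ)⟩

end Convolution

section RangeSum

variable (O : GroupoidSheafOfRings.{w} X)

/-- The sum of the values of `f` at the arrows with range `x`, for each unit `x`. -/
noncomputable def rangeSum (f : ∀ γ : Quiver.Total X, O.stalk γ.right) (x : X) : O.stalk x :=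
  ∑ᶠ β : Σ z : X, z ⟶ x, f ⟨β.1, x, β.2⟩

lemma conv_one_apply (f : ∀ γ : Quiver.Total X, O.stalk γ.right) (γ : Quiver.Total X) :
    O.conv f 1 γ = O.rangeSum f γ.right := by
  simp [conv, rangeSum]

lemma rangeSum_eq_conv_one (f : ∀ γ : Quiver.Total X, O.stalk γ.right) (x : X) :
    O.rangeSum f x = O.conv f 1 ⟨x, x, 𝟙 x⟩ :=
  (O.conv_one_apply f ⟨x, x, 𝟙 x⟩).symm

lemma rangeSum_eq_apply {f : ∀ γ : Quiver.Total X, O.stalk γ.right} (γ : Quiver.Total X)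
    (hf : ∀ β : Quiver.Total X, β.right = γ.right → β ≠ γ → f β = 0) :
    O.rangeSum f γ.right = f γ :=
  finsum_eq_single _ (⟨γ.left, γ.hom⟩ : Σ z : X, z ⟶ γ.right)
    fun _ hβ => hf _ rfl ((range_fiber_injective γ.right).ne hβ)

lemma rangeSum_extendByZero (s : ∀ x, O.stalk x) : O.rangeSum (O.extendByZero s) = s := by
  funext x
  refine (O.rangeSum_eq_apply ⟨x, x, 𝟙 x⟩ ?_).trans (O.extendByZero_unit s x)
  intro β hβ hne
  refine O.extendByZero_of_notMem s ?_
  rintro ⟨y, rfl⟩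
  exact hne (by rw [show y = x from hβ])

lemma extendByZero_rangeSum {f : ∀ γ : Quiver.Total X, O.stalk γ.right}
    (hf : O.supp f ⊆ unitArrows X) : O.extendByZero (O.rangeSum f) = f := by
  funext γ
  by_cases hγ : γ ∈ unitArrows X
  · obtain ⟨x, rfl⟩ := hγ
    refine (O.extendByZero_unit _ x).trans (O.rangeSum_eq_apply ⟨x, x, 𝟙 x⟩ ?_)
    intro β hβ hne
    by_contra h
    obtain ⟨y, rfl⟩ := hf h
    exact hne (by rw [show y = x from hβ])
  · rw [O.extendByZero_of_notMem _ hγ]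
    exact (not_not.1 fun h => hγ (hf h)).symm

lemma rangeSum_zero : O.rangeSum 0 = 0 :=
  funext fun _ => finsum_zero

lemma rangeSum_neg (f : ∀ γ : Quiver.Total X, O.stalk γ.right) :
    O.rangeSum (-f) = -O.rangeSum f :=
  funext fun _ => finsum_neg_distrib _

lemma rangeSum_add {f g : ∀ γ : Quiver.Total X, O.stalk γ.right}
    (hf : f ∈ O.convAlgebra) (hg : g ∈ O.convAlgebra) :
    O.rangeSum (f + g) = O.rangeSum f + O.rangeSum g := by
  funext x
  simp only [Pi.add_apply, rangeSum_eq_conv_one, O.add_conv hf hg]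

end RangeSum

section ConvolutionAlgebra

variable [AmpleGroupoid X] (O : GroupoidSheafOfRings.{w} X)

lemma rangeSum_mem_diagonal {f : ∀ γ : Quiver.Total X, O.stalk γ.right}
    (hf : f ∈ O.convAlgebra) : O.rangeSum f ∈ O.diagonal := by
  induction hf using AddSubgroup.closure_induction with
  | mem f hf =>
    obtain ⟨U, hU, -, hfU⟩ := hf
    have := AmpleGroupoid.t2 (X := X)
    refine O.mem_diagonal_of_continuousOn AmpleGroupoid.isLocalHomeomorph_range
      hU.isOpen hU.isCompact (hfU.1.congr fun γ hγ => ?_) fun x hx => ?_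
    · exact Sigma.ext rfl (heq_of_eq (O.rangeSum_eq_apply γ fun β hβ hne =>
        hfU.2 β fun h => hne (hU.range_injOn h hγ hβ)))
    · exact finsum_eq_zero_of_forall_eq_zero fun β => hfU.2 _ fun h => hx ⟨_, h, rfl⟩
  | zero => rw [rangeSum_zero]; exact zero_mem _
  | add f g hf hg ihf ihg => rw [O.rangeSum_add hf hg]; exact add_mem ihf ihg
  | neg f _ ih => rw [rangeSum_neg]; exact neg_mem ih

/-- Summation over the arrows with a given range, as an additive retraction of the convolution
algebra onto the diagonal. -/
noncomputable def rangeSumHom : O.convAlgebra →+ O.diagonal where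
  toFun f := ⟨O.rangeSum f.1, O.rangeSum_mem_diagonal f.2⟩
  map_zero' := Subtype.ext O.rangeSum_zero
  map_add' f g := Subtype.ext (O.rangeSum_add f.2 g.2)

lemma rangeSumHom_diagonalEmbedding (s : O.diagonal) :
    O.rangeSumHom (O.diagonalEmbedding s) = s :=
  Subtype.ext (O.rangeSum_extendByZero s.1)

lemma rangeSumHom_diagonalEmbedding_mul (s : O.diagonal) (f : O.convAlgebra) :
    O.rangeSumHom (O.diagonalEmbedding s * f) = s * O.rangeSumHom f := by
  refine Subtype.ext (funext fun x => ?_)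
  change O.rangeSum (O.conv (O.extendByZero s.1) f.1) x = s.1 x * O.rangeSum f.1 x
  rw [rangeSum_eq_conv_one, O.conv_assoc (O.extendByZero_mem s.2) f.2, extendByZero_conv,
    conv_one_apply]

lemma rangeSumHom_mul (f g : O.convAlgebra) :
    O.rangeSumHom (f * g) = O.rangeSumHom (f * O.diagonalEmbedding (O.rangeSumHom g)) := by
  have hg : O.conv g.1 1 = O.conv (O.extendByZero (O.rangeSum g.1)) 1 := by
    funext γ
    rw [extendByZero_conv, conv_one_apply, Pi.one_apply, mul_one]
  refine Subtype.ext (funext fun x => ?_)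
  change O.rangeSum (O.conv f.1 g.1) x =
    O.rangeSum (O.conv f.1 (O.extendByZero (O.rangeSum g.1))) x
  rw [rangeSum_eq_conv_one, O.conv_assoc f.2 g.2, hg, rangeSum_eq_conv_one,
    O.conv_assoc f.2 (O.extendByZero_mem (O.rangeSum_mem_diagonal g.2))]

lemma mem_range_diagonalEmbedding_iff {f : O.convAlgebra} :
    f ∈ NonUnitalRingHom.range O.diagonalEmbedding ↔ O.supp f.1 ⊆ unitArrows X := by
  constructor
  · rintro ⟨s, rfl⟩
    exact O.supp_extendByZero_subset s.1
  · intro hf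
    exact ⟨O.rangeSumHom f, Subtype.ext (O.extendByZero_rangeSum hf)⟩

lemma diagonalEmbedding_injective : Function.Injective O.diagonalEmbedding :=
  Function.LeftInverse.injective O.rangeSumHom_diagonalEmbedding

lemma diagonalEmbedding_mul_apply (s : O.diagonal) (f : O.convAlgebra) (γ : Quiver.Total X) :
    (O.diagonalEmbedding s * f).1 γ = s.1 γ.right * f.1 γ :=
  O.extendByZero_conv s.1 f.1 γ

lemma mul_diagonalEmbedding_apply (f : O.convAlgebra) (s : O.diagonal) (γ : Quiver.Total X) :
    (f * O.diagonalEmbedding s).1 γ = f.1 γ * O.act γ.hom (s.1 γ.left) :=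
  O.conv_extendByZero f.1 s.1 γ

lemma exists_diagonalEmbedding_mul_eq_self (f : O.convAlgebra) :
    ∃ s, O.diagonalEmbedding s * f = f := by
  have := AmpleGroupoid.t2 (X := X)
  obtain ⟨t, ht, hft⟩ := exists_finset_bisection_cover f.2
  have hK : IsCompact ((fun γ : Quiver.Total X => γ.right) '' ⋃ U ∈ t, U) :=
    (t.isCompact_biUnion fun U hU => (ht U hU).1.isCompact).image AmpleGroupoid.continuous_range
  obtain ⟨W, hWo, hWc, hKW⟩ := exists_isCompact_isOpen_superset hK
  refine ⟨⟨indicatorOne W, O.indicatorOne_mem_diagonal hWo hWc⟩, Subtype.ext (funext fun γ => ?_)⟩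
  rw [diagonalEmbedding_mul_apply]
  by_cases hγ : f.1 γ = 0
  · rw [hγ, mul_zero]
  · have hγW : (indicatorOne W : ∀ x, O.stalk x) γ.right = 1 :=
      indicatorOne_of_mem (hKW ⟨γ, hft hγ, rfl⟩)
    simp only [hγW, one_mul]

lemma eq_top_of_diagonalEmbedding_mem {J : TwoSidedIdeal O.convAlgebra}
    (hJ : ∀ s, O.diagonalEmbedding s ∈ J) : J = ⊤ := by
  refine top_unique fun f _ => ?_
  obtain ⟨s, hs⟩ := O.exists_diagonalEmbedding_mul_eq_self f
  exact hs ▸ J.mul_mem_right _ f (hJ s)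

lemma indicatorOne_mem_convAlgebra {U : Set (Quiver.Total X)} (hU : IsCompactOpenBisection U) :
    indicatorOne U ∈ O.convAlgebra := by
  refine AddSubgroup.subset_closure ⟨U, hU, Set.subset_univ _, ?_,
    fun _ => indicatorOne_of_notMem⟩
  refine (O.continuous_one.comp AmpleGroupoid.continuous_range).continuousOn.congr fun γ hγ => ?_
  exact Sigma.ext rfl (heq_of_eq (indicatorOne_of_mem hγ))

end ConvolutionAlgebra

section ConvolutionAlgebra
variable [AmpleGroupoid X] (O : GroupoidSheafOfRings.{w} X)

lemma indicatorOne_mul_mul_indicatorOne_inv {U : Set (Quiver.Total X)}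
    (hU : IsCompactOpenBisection U) (s : O.diagonal) :
    (⟨indicatorOne U, O.indicatorOne_mem_convAlgebra hU⟩ * O.diagonalEmbedding s *
        ⟨indicatorOne (invArrow ⁻¹' U),
          O.indicatorOne_mem_convAlgebra (AmpleGroupoid.isCompactOpenBisection_inv hU)⟩ :
          O.convAlgebra) =
      O.diagonalEmbedding ⟨O.transport U s.1, O.transport_mem hU s.2⟩ := by
  set f : O.convAlgebra :=
    ⟨indicatorOne U, O.indicatorOne_mem_convAlgebra hU⟩ * O.diagonalEmbedding s with hf
  have hfU : O.supp f.1 ⊆ U := fun γ hγ => by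
    by_contra h
    refine hγ ?_
    have h0 : (indicatorOne U : ∀ γ, O.stalk γ.right) γ = 0 := indicatorOne_of_notMem h
    simp only [hf, mul_diagonalEmbedding_apply, h0, zero_mul]
  have hsupp : O.supp (O.conv f.1 (indicatorOne (invArrow ⁻¹' U))) ⊆ mulArrows U (invArrow ⁻¹' U) :=
    (O.supp_conv_subset _ _).trans (mulArrows_mono hfU O.supp_indicatorOne_subset)
  refine Subtype.ext (funext fun γ => ?_)
  change O.conv f.1 (indicatorOne (invArrow ⁻¹' U)) γ = O.extendByZero (O.transport U s.1) γ
  by_cases hγ : γ ∈ unitArrows X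
  · obtain ⟨x, rfl⟩ := hγ
    rw [extendByZero_unit]
    by_cases hx : ∃ δ ∈ U, δ.right = x
    · obtain ⟨δ, hδ, rfl⟩ := hx
      have h1 : (indicatorOne U : ∀ γ, O.stalk γ.right) δ = 1 := indicatorOne_of_mem hδ
      rw [O.conv_indicatorOne_inv_unit hU f.1 hδ, O.transport_apply hU s.1 hδ]
      simp only [hf, mul_diagonalEmbedding_apply, h1, one_mul]
    · rw [O.transport_eq_zero s.1 hx]
      by_contra h
      obtain ⟨q, hq, hqx⟩ := hsupp h
      exact hx ⟨_, hq.1, congrArg Quiver.Total.right hqx⟩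
  · rw [extendByZero_of_notMem _ _ hγ]
    exact not_not.1 fun h => hγ (hU.mulArrows_inv_subset (hsupp h))

end ConvolutionAlgebra

section InducedIdeal

variable [AmpleGroupoid X] {O : GroupoidSheafOfRings.{w} X}

lemma isInvariantIdeal_comap (J : TwoSidedIdeal O.convAlgebra) :
    O.IsInvariantIdeal (J.comap O.diagonalEmbedding) := by
  intro U hU s hs _
  rw [TwoSidedIdeal.mem_comap] at hs ⊢
  rw [← O.indicatorOne_mul_mul_indicatorOne_inv hU s]
  exact J.mul_mem_right _ _ (J.mul_mem_left _ _ hs)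

/-- The ideal of values at `x` of the sections in an ideal of the diagonal. -/
def stalkIdeal (I : TwoSidedIdeal O.diagonal) (x : X) : TwoSidedIdeal (O.stalk x) :=
  TwoSidedIdeal.mk' {a | ∃ s ∈ I, s.1 x = a}
    ⟨0, I.zero_mem, rfl⟩
    (by
      rintro _ _ ⟨s, hs, rfl⟩ ⟨t, ht, rfl⟩
      exact ⟨s + t, I.add_mem hs ht, rfl⟩)
    (by
      rintro _ ⟨s, hs, rfl⟩
      exact ⟨-s, I.neg_mem hs, rfl⟩)
    (by
      rintro a _ ⟨s, hs, rfl⟩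
      obtain ⟨t, ht, rfl, -⟩ := O.exists_mem_diagonal_apply_eq isOpen_univ (Set.mem_univ x) a
      exact ⟨⟨t, ht⟩ * s, I.mul_mem_left _ _ hs, rfl⟩)
    (by
      rintro _ a ⟨s, hs, rfl⟩
      obtain ⟨t, ht, rfl, -⟩ := O.exists_mem_diagonal_apply_eq isOpen_univ (Set.mem_univ x) a
      exact ⟨s * ⟨t, ht⟩, I.mul_mem_right _ _ hs, rfl⟩)

lemma mem_stalkIdeal {I : TwoSidedIdeal O.diagonal} {x : X} {a : O.stalk x} :
    a ∈ stalkIdeal I x ↔ ∃ s ∈ I, s.1 x = a :=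
  TwoSidedIdeal.mem_mk' _ _ _ _ _ _ _

lemma exists_eq_one_on_and_mul_mem {I : TwoSidedIdeal O.diagonal} {s : O.diagonal}
    (hs : ∀ x, s.1 x ∈ stalkIdeal I x) {K : Set X} (hK : IsCompact K) :
    ∃ e : O.diagonal, (∀ x ∈ K, e.1 x = 1) ∧ e * s ∈ I := by
  have := AmpleGroupoid.t2 (X := X)
  refine hK.induction_on
    (p := fun K => ∃ e : O.diagonal, (∀ x ∈ K, e.1 x = 1) ∧ e * s ∈ I) ?_ ?_ ?_ ?_
  · exact ⟨0, fun _ h => h.elim, (zero_mul s).symm ▸ I.zero_mem⟩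
  · rintro K L hKL ⟨e, he, hes⟩
    exact ⟨e, fun x hx => he x (hKL hx), hes⟩
  · rintro K L ⟨e, he, hes⟩ ⟨e', he', hes'⟩
    refine ⟨e + e' - e * e', ?_, ?_⟩
    · rintro x (hx | hx)
      · simp [he x hx]
      · simp [he' x hx]
    · rw [sub_mul, add_mul, mul_assoc]
      exact I.sub_mem (I.add_mem hes hes') (I.mul_mem_left _ _ hes')
  · intro x _
    obtain ⟨t, ht, htx⟩ := mem_stalkIdeal.1 (hs x)
    obtain ⟨W, ⟨hWo, hWc⟩, hxW, hW⟩ :=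
      (AmpleGroupoid.isTopologicalBasis (X := X)).exists_subset_of_mem_open
        (show x ∈ {y | t.1 y = s.1 y} from htx) (O.isOpen_setOf_apply_eq t.2.1 s.2.1)
    let e : O.diagonal := ⟨indicatorOne W, O.indicatorOne_mem_diagonal hWo hWc⟩
    have hes : e * s = e * t := by
      refine Subtype.ext (funext fun y => ?_)
      change indicatorOne W y * s.1 y = indicatorOne W y * t.1 y
      by_cases hy : y ∈ W
      · rw [hW hy]
      · rw [indicatorOne_of_notMem hy, zero_mul, zero_mul]
    exact ⟨W, mem_nhdsWithin_of_mem_nhds (hWo.mem_nhds hxW), e,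
      fun y => indicatorOne_of_mem, hes ▸ I.mul_mem_left _ _ ht⟩

lemma mem_iff_forall_apply_mem_stalkIdeal {I : TwoSidedIdeal O.diagonal} {s : O.diagonal} :
    s ∈ I ↔ ∀ x, s.1 x ∈ stalkIdeal I x := by
  refine ⟨fun hs x => mem_stalkIdeal.2 ⟨s, hs, rfl⟩, fun hs => ?_⟩
  obtain ⟨e, he, hes⟩ := exists_eq_one_on_and_mul_mem hs s.2.2
  convert hes
  refine Subtype.ext (funext fun x => ?_)
  change s.1 x = e.1 x * s.1 x
  by_cases hx : s.1 x = 0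
  · rw [hx, mul_zero]
  · rw [he x hx, one_mul]

lemma act_mem_stalkIdeal {I : TwoSidedIdeal O.diagonal} (hI : O.IsInvariantIdeal I) {x y : X}
    (g : x ⟶ y) {a : O.stalk x} (ha : a ∈ stalkIdeal I x) : O.act g a ∈ stalkIdeal I y := by
  have := AmpleGroupoid.t2 (X := X)
  obtain ⟨s, hs, rfl⟩ := mem_stalkIdeal.1 ha
  obtain ⟨U, hU, hgU, -⟩ := AmpleGroupoid.exists_isCompactOpenBisection isOpen_univ
    (Set.mem_univ (⟨x, y, g⟩ : Quiver.Total X))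
  let W := (fun γ : Quiver.Total X => γ.left) '' U
  let e : O.diagonal := ⟨indicatorOne W, O.indicatorOne_mem_diagonal
    (AmpleGroupoid.isLocalHomeomorph_source.isOpenMap _ hU.isOpen)
    (hU.isCompact.image AmpleGroupoid.continuous_source)⟩
  have hes : ∀ z, (e * s).1 z ≠ 0 → ∃ γ ∈ U, γ.left = z := by
    intro z hz
    by_contra h
    exact left_ne_zero_of_mul hz (indicatorOne_of_notMem h)
  refine mem_stalkIdeal.2 ⟨_, hI U hU (e * s) (I.mul_mem_left _ _ hs) hes, ?_⟩
  have hxW : (indicatorOne W : ∀ z, O.stalk z) x = 1 := indicatorOne_of_mem ⟨_, hgU, rfl⟩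
  change O.transport U (e * s).1 y = O.act g (s.1 x)
  rw [O.transport_apply hU (e * s).1 hgU]
  change O.act g (indicatorOne W x * s.1 x) = _
  rw [hxW, one_mul]

/-- The ideal of the convolution algebra formed by the functions whose values lie in the stalks of
an invariant ideal of the diagonal. -/
noncomputable def inducedIdeal {I : TwoSidedIdeal O.diagonal} (hI : O.IsInvariantIdeal I) :
    TwoSidedIdeal O.convAlgebra :=
  TwoSidedIdeal.mk' {f | ∀ γ, f.1 γ ∈ stalkIdeal I γ.right}
    (fun γ => (stalkIdeal I γ.right).zero_mem)
    (fun hf hg γ => (stalkIdeal I γ.right).add_mem (hf γ) (hg γ))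
    (fun hf γ => (stalkIdeal I γ.right).neg_mem (hf γ))
    (fun hg γ => finsum_induction (· ∈ stalkIdeal I γ.right) (zero_mem _) (fun _ _ => add_mem)
      fun β => (stalkIdeal I γ.right).mul_mem_left _ _ (act_mem_stalkIdeal hI β.2 (hg _)))
    (fun hf γ => finsum_induction (· ∈ stalkIdeal I γ.right) (zero_mem _) (fun _ _ => add_mem)
      fun _ => (stalkIdeal I γ.right).mul_mem_right _ _ (hf _))

lemma mem_inducedIdeal {I : TwoSidedIdeal O.diagonal} {hI : O.IsInvariantIdeal I}
    {f : O.convAlgebra} : f ∈ inducedIdeal hI ↔ ∀ γ, f.1 γ ∈ stalkIdeal I γ.right :=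
  TwoSidedIdeal.mem_mk' _ _ _ _ _ _ _

lemma diagonalEmbedding_mem_inducedIdeal {I : TwoSidedIdeal O.diagonal}
    {hI : O.IsInvariantIdeal I} {s : O.diagonal} :
    O.diagonalEmbedding s ∈ inducedIdeal hI ↔ s ∈ I := by
  rw [mem_inducedIdeal, mem_iff_forall_apply_mem_stalkIdeal]
  refine ⟨fun h x => ?_, fun h γ => ?_⟩
  · rw [← O.extendByZero_unit s.1 x]
    exact h ⟨x, x, 𝟙 x⟩
  · change O.extendByZero s.1 γ ∈ _
    by_cases hγ : γ ∈ unitArrows X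
    · obtain ⟨x, rfl⟩ := hγ
      rw [O.extendByZero_unit s.1 x]
      exact h x
    · rw [O.extendByZero_of_notMem s.1 hγ]
      exact zero_mem _

lemma isDiagonalSimple_of_isSimpleRing [h : IsSimpleRing O.convAlgebra] : O.IsDiagonalSimple := by
  intro I hI
  refine (h.simple.eq_bot_or_eq_top (inducedIdeal hI)).imp (fun hJ => ?_) fun hJ => ?_
  · refine bot_unique fun s hs => ?_
    rw [← diagonalEmbedding_mem_inducedIdeal (hI := hI), hJ, TwoSidedIdeal.mem_bot] at hs
    rw [TwoSidedIdeal.mem_bot, ← map_eq_zero_iff _ O.diagonalEmbedding_injective, hs]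
  · refine top_unique fun s _ => ?_
    rw [← diagonalEmbedding_mem_inducedIdeal (hI := hI), hJ]
    trivial

end InducedIdeal

section RangeSumKernel

variable (O : GroupoidSheafOfRings.{w} X)

lemma diagonal_mul_comm [∀ x, IsMulCommutative (O.stalk x)] (s t : O.diagonal) : s * t = t * s :=
  Subtype.ext (funext fun x => mul_comm' (s.1 x) (t.1 x))

variable [AmpleGroupoid X]

/-- The kernel of the left action of the convolution algebra on the diagonal, in which `f` sends
`s` to the range sum of `f * s`. -/
noncomputable def rangeSumKernel : TwoSidedIdeal O.convAlgebra :=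
  TwoSidedIdeal.mk' {f | ∀ s, O.rangeSumHom (f * O.diagonalEmbedding s) = 0}
    (fun s => by rw [zero_mul, map_zero])
    (fun hf hg s => by rw [add_mul, map_add, hf, hg, add_zero])
    (fun hf s => by rw [neg_mul, map_neg, hf, neg_zero])
    (fun hf s => by rw [mul_assoc, rangeSumHom_mul, hf, map_zero, mul_zero, map_zero])
    (fun hf s => by rw [mul_assoc, rangeSumHom_mul, hf])

lemma mem_rangeSumKernel {f : O.convAlgebra} :
    f ∈ O.rangeSumKernel ↔ ∀ s, O.rangeSumHom (f * O.diagonalEmbedding s) = 0 :=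
  TwoSidedIdeal.mem_mk' _ _ _ _ _ _ _

lemma rangeSumKernel_eq_bot [h : IsSimpleRing O.convAlgebra] : O.rangeSumKernel = ⊥ := by
  refine (h.simple.eq_bot_or_eq_top _).resolve_right fun htop => ?_
  have hzero (s : O.diagonal) : O.diagonalEmbedding s = 0 := by
    obtain ⟨e, he⟩ := O.exists_diagonalEmbedding_mul_eq_self (O.diagonalEmbedding s)
    have hmem : O.diagonalEmbedding e ∈ O.rangeSumKernel := htop ▸ trivial
    have hes := O.mem_rangeSumKernel.1 hmem s
    rw [he, rangeSumHom_diagonalEmbedding] at hes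
    rw [hes, map_zero]
  exact bot_ne_top <| O.eq_top_of_diagonalEmbedding_mem fun s =>
    (TwoSidedIdeal.mem_bot _).2 (hzero s)

lemma mem_centralizer_range_diagonalEmbedding_iff {f : O.convAlgebra} :
    f ∈ NonUnitalSubring.centralizer (Set.range O.diagonalEmbedding) ↔
      ∀ s, O.diagonalEmbedding s * f = f * O.diagonalEmbedding s :=
  NonUnitalSubring.mem_centralizer_iff.trans Set.forall_mem_range

variable [∀ x, IsMulCommutative (O.stalk x)]

lemma sub_rangeSumHom_mem_rangeSumKernel {f : O.convAlgebra}
    (hf : f ∈ NonUnitalSubring.centralizer (Set.range O.diagonalEmbedding)) :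
    f - O.diagonalEmbedding (O.rangeSumHom f) ∈ O.rangeSumKernel := by
  refine O.mem_rangeSumKernel.2 fun s => ?_
  rw [sub_mul, map_sub, ← O.mem_centralizer_range_diagonalEmbedding_iff.1 hf s,
    rangeSumHom_diagonalEmbedding_mul, ← map_mul,
    rangeSumHom_diagonalEmbedding, diagonal_mul_comm, sub_self]

lemma isDiagonalMaximalCommutative_iff :
    O.IsDiagonalMaximalCommutative ↔ ∀ f ∈ NonUnitalSubring.centralizer
      (Set.range O.diagonalEmbedding), O.supp f.1 ⊆ unitArrows X := by
  have hle : NonUnitalRingHom.range O.diagonalEmbedding ≤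
      NonUnitalSubring.centralizer (Set.range O.diagonalEmbedding) := by
    rintro _ ⟨s, rfl⟩
    refine O.mem_centralizer_range_diagonalEmbedding_iff.2 fun t => ?_
    rw [← map_mul, diagonal_mul_comm, map_mul]
  rw [IsDiagonalMaximalCommutative, maximal_commutative_iff_centralizer_eq,
    NonUnitalRingHom.coe_range, le_antisymm_iff, and_iff_left hle]
  exact forall₂_congr fun f _ => O.mem_range_diagonalEmbedding_iff

lemma isDiagonalMaximalCommutative_of_isSimpleRing [IsSimpleRing O.convAlgebra] :
    O.IsDiagonalMaximalCommutative := by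
  refine O.isDiagonalMaximalCommutative_iff.2 fun f hf => ?_
  have hker := O.sub_rangeSumHom_mem_rangeSumKernel hf
  rw [rangeSumKernel_eq_bot, TwoSidedIdeal.mem_bot, sub_eq_zero] at hker
  exact O.mem_range_diagonalEmbedding_iff.1 ⟨_, hker.symm⟩

end RangeSumKernel

section Simplicity

variable [AmpleGroupoid X] {O : GroupoidSheafOfRings.{w} X}

variable (O) in
lemma nontrivial_convAlgebra [Nonempty X] [∀ x, Nontrivial (O.stalk x)] :
    Nontrivial O.convAlgebra := by
  obtain ⟨x⟩ := ‹Nonempty X›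
  obtain ⟨s, hs, hsx, -⟩ := O.exists_mem_diagonal_apply_eq isOpen_univ (Set.mem_univ x) 1
  have hne : (⟨s, hs⟩ : O.diagonal) ≠ 0 := fun h =>
    one_ne_zero (hsx.symm.trans (congrFun (congrArg Subtype.val h) x))
  exact nontrivial_of_ne _ _ (O.diagonalEmbedding_injective.ne hne)

lemma exists_mem_supp_subset_mulArrows_inv {J : TwoSidedIdeal O.convAlgebra} {f : O.convAlgebra}
    (hf : f ∈ J) {U : Set (Quiver.Total X)} (hU : IsCompactOpenBisection U) {γ : Quiver.Total X}
    (hγ : γ ∈ U) (hfγ : f.1 γ ≠ 0) :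
    ∃ g ∈ J, g ≠ 0 ∧ O.supp g.1 ⊆ mulArrows (O.supp f.1) (invArrow ⁻¹' U) := by
  refine ⟨f * ⟨_, O.indicatorOne_mem_convAlgebra (AmpleGroupoid.isCompactOpenBisection_inv hU)⟩,
    J.mul_mem_right _ _ hf, fun h => hfγ ?_,
    (O.supp_conv_subset _ _).trans (mulArrows_mono subset_rfl O.supp_indicatorOne_subset)⟩
  rw [← O.conv_indicatorOne_inv_unit hU f.1 hγ]
  exact congrFun (congrArg Subtype.val h) _

variable [∀ x, IsMulCommutative (O.stalk x)]

lemma supp_commutator_subset (s : O.diagonal) (f : O.convAlgebra) :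
    O.supp (O.diagonalEmbedding s * f - f * O.diagonalEmbedding s).1 ⊆
      O.supp f.1 \ unitArrows X := by
  intro γ hγ
  change (O.diagonalEmbedding s * f).1 γ - (f * O.diagonalEmbedding s).1 γ ≠ 0 at hγ
  rw [diagonalEmbedding_mul_apply, mul_diagonalEmbedding_apply] at hγ
  refine ⟨fun hf => hγ (by rw [hf, mul_zero, zero_mul, sub_zero]), ?_⟩
  rintro ⟨x, rfl⟩
  exact hγ (by rw [O.act_id, mul_comm' (s.1 x), sub_self])

lemma exists_diagonalEmbedding_mem (hmax : O.IsDiagonalMaximalCommutative)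
    {J : TwoSidedIdeal O.convAlgebra} {ι : Type*} (t : Finset ι) :
    ∀ {U : ι → Set (Quiver.Total X)} {f : O.convAlgebra}, (∀ i ∈ t, IsCompactOpenBisection (U i)) →
      O.supp f.1 ⊆ ⋃ i ∈ t, U i → f ∈ J → f ≠ 0 → ∃ s ≠ 0, O.diagonalEmbedding s ∈ J := by
  induction t using Finset.cons_induction with
  | empty =>
    intro U f _ hfU _ hf0
    exact absurd (Subtype.ext (funext fun γ => not_not.1 fun h => by simpa using hfU h)) hf0
  | cons i t _ ih =>
    intro U f hU hfU hfJ hf0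
    simp only [Finset.mem_cons, forall_eq_or_imp] at hU
    simp only [Finset.mem_cons, Set.iUnion_iUnion_eq_or_left] at hfU
    by_cases hfi : ∀ γ ∈ U i, f.1 γ = 0
    · exact ih hU.2 (fun γ hγ => (hfU hγ).resolve_left fun h => hγ (hfi γ h)) hfJ hf0
    push Not at hfi
    obtain ⟨γ, hγ, hfγ⟩ := hfi
    obtain ⟨g, hgJ, hg0, hgU⟩ := exists_mem_supp_subset_mulArrows_inv hfJ hU.1 hγ hfγ
    by_cases hgc : g ∈ NonUnitalSubring.centralizer (Set.range O.diagonalEmbedding)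
    · obtain ⟨s, rfl⟩ := O.mem_range_diagonalEmbedding_iff.2
        (O.isDiagonalMaximalCommutative_iff.1 hmax g hgc)
      exact ⟨s, ne_of_apply_ne O.diagonalEmbedding (by rwa [map_zero]), hgJ⟩
    · rw [mem_centralizer_range_diagonalEmbedding_iff] at hgc
      push Not at hgc
      obtain ⟨s, hs⟩ := hgc
      refine ih (U := fun j => mulArrows (U j) (invArrow ⁻¹' U i))
        (fun j hj => AmpleGroupoid.isCompactOpenBisection_mul (hU.2 j hj)
          (AmpleGroupoid.isCompactOpenBisection_inv hU.1)) (fun δ hδ => ?_)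
        (J.sub_mem (J.mul_mem_left _ _ hgJ) (J.mul_mem_right _ _ hgJ)) (sub_ne_zero.2 hs)
      obtain ⟨hδg, hδu⟩ := supp_commutator_subset s g hδ
      obtain ⟨q, ⟨hq | hq, hq'⟩, rfl⟩ := mulArrows_mono hfU subset_rfl (hgU hδg)
      · exact absurd (hU.1.mulArrows_inv_subset ⟨q, ⟨hq, hq'⟩, rfl⟩) hδu
      · obtain ⟨j, hj, hqj⟩ := Set.mem_iUnion₂.1 hq
        exact Set.mem_biUnion hj ⟨q, ⟨hqj, hq'⟩, rfl⟩

lemma eq_bot_or_eq_top_of_isDiagonalSimple (hsimple : O.IsDiagonalSimple)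
    (hmax : O.IsDiagonalMaximalCommutative) (J : TwoSidedIdeal O.convAlgebra) :
    J = ⊥ ∨ J = ⊤ := by
  refine (hsimple _ (isInvariantIdeal_comap J)).imp (fun hbot => ?_) fun htop => ?_
  · refine bot_unique fun f hf => (TwoSidedIdeal.mem_bot _).2 (by_contra fun hf0 => ?_)
    obtain ⟨t, ht, hft⟩ := exists_finset_bisection_cover f.2
    obtain ⟨s, hs0, hs⟩ :=
      exists_diagonalEmbedding_mem hmax t (fun U hU => (ht U hU).1) hft hf hf0
    rw [← TwoSidedIdeal.mem_comap, hbot, TwoSidedIdeal.mem_bot] at hs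
    exact hs0 hs
  · exact O.eq_top_of_diagonalEmbedding_mem fun s => (TwoSidedIdeal.mem_comap _).1 (htop ▸ trivial)

variable (O) in
theorem isSimpleRing_convAlgebra_iff [Nontrivial O.convAlgebra] :
    IsSimpleRing O.convAlgebra ↔ O.IsDiagonalSimple ∧ O.IsDiagonalMaximalCommutative := by
  constructor
  · intro
    exact ⟨isDiagonalSimple_of_isSimpleRing, O.isDiagonalMaximalCommutative_of_isSimpleRing⟩
  · rintro ⟨hsimple, hmax⟩
    exact ⟨⟨eq_bot_or_eq_top_of_isDiagonalSimple hsimple hmax⟩⟩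

end Simplicity

section Minimality

lemma IsSheafOfFields.isSimpleRing_stalk {O : GroupoidSheafOfRings.{w} X}
    (hO : O.IsSheafOfFields) (x : X) : IsSimpleRing (O.stalk x) := by
  let := (hO x).toField
  exact (inferInstance : IsSimpleRing (O.stalk x))

variable {O : GroupoidSheafOfRings.{w} X}

/-- The ideal of the sections over the unit space that vanish outside of a given set. -/
def idealOfSet (O : GroupoidSheafOfRings.{w} X) (V : Set X) : TwoSidedIdeal O.diagonal :=
  TwoSidedIdeal.mk' {s | ∀ x ∉ V, s.1 x = 0}
    (fun _ _ => rfl)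
    (fun {s t} hs ht x hx => by
      change s.1 x + t.1 x = 0
      rw [hs x hx, ht x hx, add_zero])
    (fun {s} hs x hx => neg_eq_zero.2 (hs x hx))
    (fun {s t} ht x hx => mul_eq_zero_of_right (s.1 x) (ht x hx))
    (fun {s t} hs x hx => mul_eq_zero_of_left (hs x hx) (t.1 x))

lemma mem_idealOfSet {V : Set X} {s : O.diagonal} :
    s ∈ O.idealOfSet V ↔ ∀ x ∉ V, s.1 x = 0 :=
  TwoSidedIdeal.mem_mk' _ _ _ _ _ _ _

variable [AmpleGroupoid X]

lemma isOpen_setOf_stalkIdeal_eq_top (I : TwoSidedIdeal O.diagonal) :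
    IsOpen {x | stalkIdeal I x = ⊤} := by
  refine isOpen_iff_mem_nhds.2 fun x hx => ?_
  obtain ⟨s, hs, hsx⟩ := mem_stalkIdeal.1 ((stalkIdeal I x).one_mem_iff.2 hx)
  filter_upwards [(O.isOpen_setOf_apply_eq s.2.1 O.continuous_one).mem_nhds hsx] with y hy
  exact (stalkIdeal I y).one_mem_iff.1 (mem_stalkIdeal.2 ⟨s, hs, hy⟩)

lemma isDiagonalSimple_of_isMinimalGroupoid [∀ x, IsSimpleRing (O.stalk x)]
    (hX : IsMinimalGroupoid X) : O.IsDiagonalSimple := by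
  intro I hI
  have hinv (γ : Quiver.Total X) (hγ : stalkIdeal I γ.left = ⊤) : stalkIdeal I γ.right = ⊤ := by
    rw [← TwoSidedIdeal.one_mem_iff] at hγ ⊢
    exact map_one (O.act γ.hom) ▸ act_mem_stalkIdeal hI γ.hom hγ
  refine (hX _ (isOpen_setOf_stalkIdeal_eq_top I) hinv).imp (fun hempty => ?_) fun huniv => ?_
  · have hbot (x : X) : stalkIdeal I x = ⊥ :=
      (IsSimpleRing.simple.eq_bot_or_eq_top _).resolve_right fun h =>
        hempty.subset (show x ∈ {x | stalkIdeal I x = ⊤} from h)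
    refine bot_unique fun s hs => (TwoSidedIdeal.mem_bot _).2 (Subtype.ext (funext fun x => ?_))
    have hsx := mem_iff_forall_apply_mem_stalkIdeal.1 hs x
    rwa [hbot, TwoSidedIdeal.mem_bot] at hsx
  · refine top_unique fun s _ => mem_iff_forall_apply_mem_stalkIdeal.2 fun x => ?_
    rw [show stalkIdeal I x = ⊤ from huniv.superset (Set.mem_univ x)]
    trivial

lemma isInvariantIdeal_idealOfSet {V : Set X}
    (hV : ∀ γ : Quiver.Total X, γ.left ∈ V → γ.right ∈ V) :
    O.IsInvariantIdeal (O.idealOfSet V) := by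
  intro U hU s hs _
  refine mem_idealOfSet.2 fun x hx => ?_
  by_cases hxU : ∃ γ ∈ U, γ.right = x
  · obtain ⟨γ, hγ, rfl⟩ := hxU
    change O.transport U s.1 γ.right = 0
    rw [O.transport_apply hU s.1 hγ, mem_idealOfSet.1 hs _ (mt (hV γ) hx), map_zero]
  · exact O.transport_eq_zero s.1 hxU

lemma IsDiagonalSimple.isMinimalGroupoid [∀ x, Nontrivial (O.stalk x)]
    (hO : O.IsDiagonalSimple) : IsMinimalGroupoid X := by
  intro V hVo hV
  refine (hO _ (isInvariantIdeal_idealOfSet hV)).imp (fun hbot => ?_) fun htop => ?_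
  · refine Set.eq_empty_of_forall_notMem fun x hx => ?_
    obtain ⟨s, hs, hsx, hsV⟩ := O.exists_mem_diagonal_apply_eq hVo hx 1
    have hmem : (⟨s, hs⟩ : O.diagonal) ∈ O.idealOfSet V := mem_idealOfSet.2 hsV
    rw [hbot, TwoSidedIdeal.mem_bot] at hmem
    exact one_ne_zero (hsx.symm.trans (congrFun (congrArg Subtype.val hmem) x))
  · refine Set.eq_univ_of_forall fun x => by_contra fun hx => ?_
    obtain ⟨s, hs, hsx, -⟩ := O.exists_mem_diagonal_apply_eq isOpen_univ (Set.mem_univ x) 1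
    have hmem : (⟨s, hs⟩ : O.diagonal) ∈ O.idealOfSet V := htop ▸ trivial
    exact one_ne_zero (hsx.symm.trans (mem_idealOfSet.1 hmem x hx))

variable (O) in
theorem isDiagonalSimple_iff_isMinimalGroupoid [∀ x, IsSimpleRing (O.stalk x)] :
    O.IsDiagonalSimple ↔ IsMinimalGroupoid X :=
  ⟨fun h => h.isMinimalGroupoid, isDiagonalSimple_of_isMinimalGroupoid⟩

end Minimality

section Kernel

variable {O : GroupoidSheafOfRings.{w} X}

lemma supp_subset_of_mem_sectionsIn {H : Set (Quiver.Total X)}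
    {f : ∀ γ : Quiver.Total X, O.stalk γ.right} (hf : f ∈ O.sectionsIn H) : O.supp f ⊆ H := by
  obtain ⟨t, ht, hft⟩ := exists_finset_bisection_cover hf
  exact hft.trans (Set.iUnion₂_subset fun U hU => (ht U hU).2)

lemma sectionsIn_le_convAlgebra (H : Set (Quiver.Total X)) : O.sectionsIn H ≤ O.convAlgebra :=
  AddSubgroup.closure_mono fun _ ⟨U, hU, _, hf⟩ => ⟨U, hU, Set.subset_univ U, hf⟩

lemma unitArrows_subset_ker : unitArrows X ⊆ O.ker := by
  rintro _ ⟨x, rfl⟩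
  exact ⟨x, 𝟙 x, rfl, O.act_id x⟩

variable [AmpleGroupoid X]

lemma extendByZero_mem_sectionsIn {s : ∀ x, O.stalk x} (hs : s ∈ O.diagonal) :
    O.extendByZero s ∈ O.sectionsIn (unitArrows X) := by
  obtain ⟨W, hWo, hWc, hsW⟩ := exists_isCompact_isOpen_superset hs.2
  refine AddSubgroup.subset_closure ⟨_, AmpleGroupoid.isCompactOpenBisection_unit_image hWo hWc,
    Set.image_subset_range _ W, ?_, fun γ hγ => ?_⟩
  · refine (hs.1.comp AmpleGroupoid.continuous_range).continuousOn.congr ?_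
    rintro _ ⟨x, -, rfl⟩
    exact Sigma.ext rfl (heq_of_eq (O.extendByZero_unit s x))
  · by_contra h
    obtain ⟨x, rfl⟩ := O.supp_extendByZero_subset s h
    rw [O.extendByZero_unit] at h
    exact hγ ⟨x, hsW h, rfl⟩

lemma coe_sectionsIn_unitArrows :
    (O.sectionsIn (unitArrows X) : Set (∀ γ : Quiver.Total X, O.stalk γ.right)) =
      {f | f ∈ O.convAlgebra ∧ O.supp f ⊆ unitArrows X} := by
  refine Set.Subset.antisymm
    (fun f hf => ⟨sectionsIn_le_convAlgebra _ hf, supp_subset_of_mem_sectionsIn hf⟩) ?_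
  rintro f ⟨hf, hsupp⟩
  rw [← O.extendByZero_rangeSum hsupp]
  exact extendByZero_mem_sectionsIn (O.rangeSum_mem_diagonal hf)

lemma interior_ker_eq_unitArrows_of_forall_supp_subset [∀ x, Nontrivial (O.stalk x)]
    (h : ∀ f ∈ O.convAlgebra, O.supp f ⊆ O.ker → O.supp f ⊆ unitArrows X) :
    interior O.ker = unitArrows X := by
  refine Set.Subset.antisymm (fun γ hγ => ?_)
    (interior_maximal unitArrows_subset_ker AmpleGroupoid.isOpen_unitArrows)
  obtain ⟨U, hU, hγU, hUker⟩ := AmpleGroupoid.exists_isCompactOpenBisection isOpen_interior hγ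
  refine h _ (O.indicatorOne_mem_convAlgebra hU)
    (O.supp_indicatorOne_subset.trans (hUker.trans interior_subset)) ?_
  exact (indicatorOne_of_mem hγU).trans_ne one_ne_zero

lemma interior_ker_and_sectionsIn_eq_iff [∀ x, Nontrivial (O.stalk x)] :
    (interior O.ker = unitArrows X ∧
        (O.sectionsIn (interior O.ker) : Set (∀ γ : Quiver.Total X, O.stalk γ.right)) =
          {f | f ∈ O.convAlgebra ∧ O.supp f ⊆ O.ker}) ↔
      ∀ f ∈ O.convAlgebra, O.supp f ⊆ O.ker → O.supp f ⊆ unitArrows X := by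
  constructor
  · rintro ⟨hint, hsections⟩ f hf hfker
    rw [hint] at hsections
    exact supp_subset_of_mem_sectionsIn (hsections.superset ⟨hf, hfker⟩)
  · intro h
    have hint := interior_ker_eq_unitArrows_of_forall_supp_subset h
    refine ⟨hint, ?_⟩
    rw [hint, coe_sectionsIn_unitArrows]
    exact Set.ext fun f => and_congr_right fun hf =>
      ⟨fun hsupp => hsupp.trans unitArrows_subset_ker, h f hf⟩

end Kernel

section Centralizer

variable [AmpleGroupoid X] {O : GroupoidSheafOfRings.{w} X} [∀ x, IsMulCommutative (O.stalk x)]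

lemma mem_centralizer_of_supp_subset_ker {f : O.convAlgebra} (hf : O.supp f.1 ⊆ O.ker) :
    f ∈ NonUnitalSubring.centralizer (Set.range O.diagonalEmbedding) := by
  refine O.mem_centralizer_range_diagonalEmbedding_iff.2 fun s => ?_
  refine Subtype.ext (funext fun γ => ?_)
  rw [diagonalEmbedding_mul_apply, mul_diagonalEmbedding_apply]
  by_cases hγ : f.1 γ = 0
  · rw [hγ, mul_zero, zero_mul]
  · obtain ⟨x, g, rfl, hg⟩ := hf hγ
    rw [hg, mul_comm' (s.1 x)]

lemma supp_subset_ker_of_mem_centralizer [∀ x, IsDomain (O.stalk x)] {f : O.convAlgebra}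
    (hf : f ∈ NonUnitalSubring.centralizer (Set.range O.diagonalEmbedding)) :
    O.supp f.1 ⊆ O.ker := by
  intro γ hγ
  have := AmpleGroupoid.t2 (X := X)
  have hact (s : O.diagonal) : O.act γ.hom (s.1 γ.left) = s.1 γ.right := by
    refine mul_left_cancel₀ (show f.1 γ ≠ 0 from hγ) ?_
    rw [← mul_diagonalEmbedding_apply, ← O.mem_centralizer_range_diagonalEmbedding_iff.1 hf s,
      diagonalEmbedding_mul_apply, mul_comm']
  obtain ⟨x, y, g⟩ := γ
  obtain rfl : y = x := by
    by_contra hyx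
    obtain ⟨s, hs, hsy, hsx⟩ := O.exists_mem_diagonal_apply_eq isOpen_compl_singleton hyx 1
    have h : O.act g (s x) = s y := hact ⟨s, hs⟩
    rw [hsy, hsx x (by simp), map_zero] at h
    exact zero_ne_one h
  refine ⟨y, g, rfl, fun a => ?_⟩
  obtain ⟨s, hs, rfl, -⟩ := O.exists_mem_diagonal_apply_eq isOpen_univ (Set.mem_univ y) a
  exact hact ⟨s, hs⟩

variable (O) in
theorem isDiagonalMaximalCommutative_iff_interior_ker [∀ x, IsDomain (O.stalk x)] :
    O.IsDiagonalMaximalCommutative ↔ interior O.ker = unitArrows X ∧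
      (O.sectionsIn (interior O.ker) : Set (∀ γ : Quiver.Total X, O.stalk γ.right)) =
        {f | f ∈ O.convAlgebra ∧ O.supp f ⊆ O.ker} := by
  rw [isDiagonalMaximalCommutative_iff, interior_ker_and_sectionsIn_eq_iff]
  exact ⟨fun h f hf hfker => h ⟨f, hf⟩ (mem_centralizer_of_supp_subset_ker hfker),
    fun h f hf => h f.1 f.2 (supp_subset_ker_of_mem_centralizer hf)⟩

end Centralizer

section Hausdorff

variable [AmpleGroupoid X] {O : GroupoidSheafOfRings.{w} X} [T2Space (Quiver.Total X)]

lemma continuous_of_mem_convAlgebra {f : ∀ γ : Quiver.Total X, O.stalk γ.right}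
    (hf : f ∈ O.convAlgebra) : Continuous fun γ => (⟨γ.right, f γ⟩ : Σ x, O.stalk x) := by
  have hzero : Continuous fun γ : Quiver.Total X => (⟨γ.right, 0⟩ : Σ x, O.stalk x) :=
    O.continuous_zero.comp AmpleGroupoid.continuous_range
  induction hf using AddSubgroup.closure_induction with
  | mem f hf =>
    obtain ⟨U, hU, -, hfU, hf0⟩ := hf
    have hfUc : ContinuousOn (fun γ => (⟨γ.right, f γ⟩ : Σ x, O.stalk x)) Uᶜ :=
      hzero.continuousOn.congr fun γ hγ => Sigma.ext rfl (heq_of_eq (hf0 γ hγ))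
    rw [← continuousOn_univ, ← Set.union_compl_self U]
    exact hfU.union_of_isOpen hfUc hU.isOpen hU.isCompact.isClosed.isOpen_compl
  | zero => exact hzero
  | add f g _ _ hf hg =>
    exact O.continuous_add.comp
      (f := fun γ : Quiver.Total X => (⟨γ.right, f γ, g γ⟩ : FiberPair O.stalk))
      (isInducing_fiberPair.continuous_iff.2 (hf.prodMk hg))
  | neg f _ hf => exact O.continuous_neg.comp hf

lemma IsSheafOfFields.isOpen_supp (hO : O.IsSheafOfFields)
    {f : ∀ γ : Quiver.Total X, O.stalk γ.right} (hf : f ∈ O.convAlgebra) :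
    IsOpen (O.supp f) := by
  convert O.isOpen_setOf_exists_mul_eq_one.preimage (continuous_of_mem_convAlgebra hf) using 1
  ext γ
  refine ⟨fun hγ => (hO γ.right).mul_inv_cancel hγ, ?_⟩
  rintro ⟨b, hb⟩ hγ
  have := (hO γ.right).nontrivial
  exact zero_ne_one ((mul_eq_zero_of_left hγ b).symm.trans hb)

lemma IsSheafOfFields.interior_ker_and_sectionsIn_eq_iff (hO : O.IsSheafOfFields) :
    (interior O.ker = unitArrows X ∧
        (O.sectionsIn (interior O.ker) : Set (∀ γ : Quiver.Total X, O.stalk γ.right)) =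
          {f | f ∈ O.convAlgebra ∧ O.supp f ⊆ O.ker}) ↔ interior O.ker = unitArrows X := by
  have := fun x => (hO x).nontrivial
  refine ⟨And.left, fun hint => O.interior_ker_and_sectionsIn_eq_iff.2 fun f hf hfker => ?_⟩
  exact (interior_maximal hfker (hO.isOpen_supp hf)).trans hint.subset

end Hausdorff

end GroupoidSheafOfRings

theorem mainTheorem5 {X : Type u} [Groupoid.{v} X] [TopologicalSpace X]
    [TopologicalSpace (Quiver.Total X)] [AmpleGroupoid X] [Nonempty X]
    (O : GroupoidSheafOfRings.{w} X) (hO : O.IsSheafOfFields) :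
    List.TFAE
      [IsSimpleRing O.convAlgebra,
        O.IsDiagonalSimple ∧ O.IsDiagonalMaximalCommutative,
        IsMinimalGroupoid X ∧ interior O.ker = unitArrows X ∧
          (O.sectionsIn (interior O.ker) : Set (∀ γ : Quiver.Total X, O.stalk γ.right)) =
            {f | f ∈ O.convAlgebra ∧ O.supp f ⊆ O.ker}] ∧
    (T2Space (Quiver.Total X) →
      List.TFAE
        [IsSimpleRing O.convAlgebra,
          O.IsDiagonalSimple ∧ O.IsDiagonalMaximalCommutative,
          IsMinimalGroupoid X ∧ interior O.ker = unitArrows X ∧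
            (O.sectionsIn (interior O.ker) : Set (∀ γ : Quiver.Total X, O.stalk γ.right)) =
              {f | f ∈ O.convAlgebra ∧ O.supp f ⊆ O.ker},
          IsMinimalGroupoid X ∧ interior O.ker = unitArrows X]) := by
  have := fun x => (hO x).isDomain
  have := hO.isSimpleRing_stalk
  have (x : X) : IsMulCommutative (O.stalk x) := ⟨⟨(hO x).mul_comm⟩⟩
  have := O.nontrivial_convAlgebra
  have h₁₂ := O.isSimpleRing_convAlgebra_iff
  have h₂₃ := and_congr O.isDiagonalSimple_iff_isMinimalGroupoid
    O.isDiagonalMaximalCommutative_iff_interior_ker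
  refine ⟨?_, fun _ => ?_⟩
  · tfae_have 1 ↔ 2 := h₁₂
    tfae_have 2 ↔ 3 := h₂₃
    tfae_finish
  · tfae_have 1 ↔ 2 := h₁₂
    tfae_have 2 ↔ 3 := h₂₃
    tfae_have 3 ↔ 4 := and_congr_right' hO.interior_ker_and_sectionsIn_eq_iff
    tfae_finish
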